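/- Let $(P,\Pi)$ be a (smooth, finite-dimensional) Poisson manifold, i.e. $\Pi$ is a smooth bivector field on $P$ with $[\Pi,\Pi]=0$, and let $\sharp\colon T^*P\to TP$ be contraction with $\Pi$. Let $M\subset P$ be an embedded $m$-dimensional submanifold with conormal bundle $N^*M$ (the annihilator of $TM$ in $T^*P|_M$). Suppose that $M$ is coisotropic, i.e. $\sharp N^*M\subset TM$, and that $\sharp N^*M$ has constant rank equal to the codimension $k:=\dim P-m$ of $M$. Then about every point $x\in M$ there are an open neighbourhood $U\subset P$ and smooth coordinates $(q_1,\dots,q_k,p_1,\dots,p_k,y_1,\dots,y_{m-k})$ on $U$ such that $$M\cap U=\{z\in U : p_1(z)=\dots=p_k(z)=0\}$$ and, on $U$, $$\Pi=\sum_{I=1}^k \partial_{q_I}\wedge\partial_{p_I}+\sum_{i,j=1}^{m-k}\varphi_{ij}(y)\,\partial_{y_i}\wedge\partial_{y_j}$$ for smooth functions $\varphi_{ij}\colon\mathbb R^{m-k}\to\mathbb R$. -/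

import Mathlib

open scoped Manifold ContDiff

set_option maxSynthPendingDepth 3

noncomputable section

namespace PoissonGeom

/-- The cotangent space `T*_x P` of a manifold modelled on `ℝⁿ`. -/
abbrev Cotangent (n : ℕ) {P : Type*} [TopologicalSpace P]
    [ChartedSpace (EuclideanSpace ℝ (Fin n)) P] (x : P) : Type :=
  TangentSpace (𝓡 n) x →L[ℝ] ℝ

/-- A smooth bivector field on a manifold `P` modelled on `ℝⁿ`: a smooth family of
skew-symmetric bilinear forms on the cotangent spaces, i.e. a smooth section of
`Hom(T*P, Hom(T*P, ℝ))` that is skew-symmetric at each point. -/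
structure BivectorField (n : ℕ) (P : Type*) [TopologicalSpace P]
    [ChartedSpace (EuclideanSpace ℝ (Fin n)) P] [IsManifold (𝓡 n) ∞ P] where
  /-- the value at a point, as a bilinear form on covectors -/
  toFun (x : P) : Cotangent n x →L[ℝ] Cotangent n x →L[ℝ] ℝ
  skew (x : P) (α β : Cotangent n x) : toFun x α β = - toFun x β α
  smooth : ContMDiff (𝓡 n)
    ((𝓡 n).prod 𝓘(ℝ, (EuclideanSpace ℝ (Fin n) →L[ℝ] ℝ) →L[ℝ]
      (EuclideanSpace ℝ (Fin n) →L[ℝ] ℝ) →L[ℝ] ℝ)) ∞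
    (fun x ↦ Bundle.TotalSpace.mk' ((EuclideanSpace ℝ (Fin n) →L[ℝ] ℝ) →L[ℝ]
      (EuclideanSpace ℝ (Fin n) →L[ℝ] ℝ) →L[ℝ] ℝ)
      (E := fun x : P ↦ Cotangent n x →L[ℝ] Cotangent n x →L[ℝ] ℝ) x (toFun x))

variable {n : ℕ} {P : Type*} [TopologicalSpace P]
  [ChartedSpace (EuclideanSpace ℝ (Fin n)) P] [IsManifold (𝓡 n) ∞ P]

/-- The bracket `{f, g} = Π(df, dg)` of two functions. -/
def BivectorField.bracket (B : BivectorField n P) (f g : P → ℝ) (x : P) : ℝ :=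
  B.toFun x (mvfderiv (𝓡 n) f x) (mvfderiv (𝓡 n) g x)

/-- The Schouten bracket `[Π, Π]`, a trivector field, evaluated on exact 1-forms:
`[Π, Π](df, dg, dh) = 2 ({f, {g, h}} + {g, {h, f}} + {h, {f, g}})` (up to the overall sign, which
depends on conventions). -/
def BivectorField.schoutenSquare (B : BivectorField n P) (f g h : P → ℝ) (x : P) : ℝ :=
  2 * (B.bracket f (B.bracket g h) x + B.bracket g (B.bracket h f) x
    + B.bracket h (B.bracket f g) x)

/-- `Π` is a Poisson structure: `[Π, Π] = 0`. The trivector `[Π, Π]` is tested on differentials of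
locally defined smooth functions, which span the cotangent space at each point. -/
def BivectorField.IsPoisson (B : BivectorField n P) : Prop :=
  ∀ (U : Set P), IsOpen U → ∀ f g h : P → ℝ,
    ContMDiffOn (𝓡 n) 𝓘(ℝ, ℝ) ∞ f U → ContMDiffOn (𝓡 n) 𝓘(ℝ, ℝ) ∞ g U →
    ContMDiffOn (𝓡 n) 𝓘(ℝ, ℝ) ∞ h U → ∀ x ∈ U, B.schoutenSquare f g h x = 0

instance (x : P) : FiniteDimensional ℝ (TangentSpace (𝓡 n) x) :=
  inferInstanceAs (FiniteDimensional ℝ (EuclideanSpace ℝ (Fin n)))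

instance (x : P) : T2Space (TangentSpace (𝓡 n) x) :=
  inferInstanceAs (T2Space (EuclideanSpace ℝ (Fin n)))

/-- The sharp map `♯ : T*_x P → T_x P`, `♯ξ = Π(ξ, ·)`, a vector being identified with the
functional it induces on covectors. -/
def BivectorField.sharp (B : BivectorField n P) (x : P) :
    Cotangent n x →ₗ[ℝ] TangentSpace (𝓡 n) x where
  toFun ξ := (Module.evalEquiv ℝ (TangentSpace (𝓡 n) x)).symm
    ((B.toFun x ξ).toLinearMap ∘ₗ (LinearMap.toContinuousLinearMap :
      (TangentSpace (𝓡 n) x →ₗ[ℝ] ℝ) ≃ₗ[ℝ] Cotangent n x).toLinearMap)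
  map_add' ξ η := by
    rw [← map_add]
    congr 1
    ext ζ
    simp
  map_smul' c ξ := by
    rw [RingHom.id_apply, ← map_smul]
    congr 1
    ext ζ
    simp

/-- The defining property `⟨η, ♯ξ⟩ = Π(ξ, η)` of the sharp map. -/
theorem BivectorField.apply_sharp (B : BivectorField n P) (x : P) (ξ η : Cotangent n x) :
    η (B.sharp x ξ) = B.toFun x ξ η := by
  have h := Module.apply_evalEquiv_symm_apply (R := ℝ) (M := TangentSpace (𝓡 n) x)
    η.toLinearMap ((B.toFun x ξ).toLinearMap ∘ₗ (LinearMap.toContinuousLinearMap :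
      (TangentSpace (𝓡 n) x →ₗ[ℝ] ℝ) ≃ₗ[ℝ] Cotangent n x).toLinearMap)
  exact h

section Submanifold

variable {m : ℕ} {M : Type*} [TopologicalSpace M]
  [ChartedSpace (EuclideanSpace ℝ (Fin m)) M]

/-- The tangent space `T_{i y} M ⊆ T_{i y} P` of a submanifold `i : M → P` at the point `y`. -/
def tangentSub (i : M → P) (y : M) : Submodule ℝ (TangentSpace (𝓡 n) (i y)) :=
  LinearMap.range (mfderiv (𝓡 m) (𝓡 n) i y).toLinearMap

/-- The fibre at `y` of the conormal bundle `N*M`: the covectors that annihilate `TM`. -/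
def conormal (i : M → P) (y : M) : Submodule ℝ (Cotangent n (i y)) where
  carrier := {ξ | ∀ v ∈ tangentSub (m := m) (n := n) i y, ξ v = 0}
  zero_mem' := fun _ _ ↦ rfl
  add_mem' := fun {a b} ha hb v hv ↦ by simp [ha v hv, hb v hv]
  smul_mem' := fun c a ha v hv ↦ by simp [ha v hv]

/-- The fibre at `y` of `♯N*M`. -/
def BivectorField.sharpConormal (B : BivectorField n P) (i : M → P) (y : M) :
    Submodule ℝ (TangentSpace (𝓡 n) (i y)) :=
  (conormal (m := m) (n := n) i y).map (B.sharp (i y))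

/-- The submanifold `i : M → P` is coisotropic: `♯N*M ⊆ TM`. -/
def BivectorField.IsCoisotropic (B : BivectorField n P) (i : M → P) : Prop :=
  ∀ y : M, B.sharpConormal (m := m) i y ≤ tangentSub (m := m) (n := n) i y

end Submanifold

/-- The coordinate space with coordinates `(q_1, …, q_k, p_1, …, p_k, y_1, …, y_l)`, the three
blocks of indices being embedded by `iq`, `ip` and `iy`. -/
abbrev CoordSpace (k l : ℕ) : Type := EuclideanSpace ℝ (Fin k ⊕ Fin k ⊕ Fin l)

/-- index of the coordinate `q_I` -/
abbrev iq {k l : ℕ} (I : Fin k) : Fin k ⊕ Fin k ⊕ Fin l := Sum.inl I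

/-- index of the coordinate `p_I` -/
abbrev ip {k l : ℕ} (I : Fin k) : Fin k ⊕ Fin k ⊕ Fin l := Sum.inr (Sum.inl I)

/-- index of the coordinate `y_j` -/
abbrev iy {k l : ℕ} (j : Fin l) : Fin k ⊕ Fin k ⊕ Fin l := Sum.inr (Sum.inr j)

/-- The `y`-part of a point of the coordinate space. -/
def yPart {k l : ℕ} (z : CoordSpace k l) : EuclideanSpace ℝ (Fin l) :=
  WithLp.toLp 2 (fun j ↦ z (iy j))

/-- The coordinate vector field `∂_a` of the coordinate system `e`, at the point of `P` with
coordinates `z`. -/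
def coordVec {k l : ℕ} (e : OpenPartialHomeomorph P (CoordSpace k l)) (a : Fin k ⊕ Fin k ⊕ Fin l)
    (z : CoordSpace k l) : TangentSpace (𝓡 n) (e.symm z) :=
  mfderiv 𝓘(ℝ, CoordSpace k l) (𝓡 n) e.symm z (EuclideanSpace.single a (1 : ℝ))

/-- The value of the bivector `v ∧ w` on a pair of covectors. -/
def wedge {x : P} (v w : TangentSpace (𝓡 n) x) (α β : Cotangent n x) : ℝ :=
  α v * β w - α w * β v

end PoissonGeom

end

/-! In a chart that straightens `M`, the statement concerns a Poisson bivector near a point `x₀` of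
a linear subspace `V` of `ℝⁿ` (`exists_slice_chart`, `BivectorField.inChart`). There it is a
relative form of Weinstein's splitting theorem, the `p`-coordinates being required to vanish on `V`.

Everything rests on one Cauchy problem. If `{G, H} ≠ 0` at `x₀`, the Hamiltonian field of `G` is
transverse to the level set of `H`, so any `f` can be replaced by an `F` with `{G, F} = 0` that
equals `f` on this level set (`exists_first_integral`). If `{K, G}` is constant, the Jacobi identity
gives `{G, {K, F}} = {K, {G, F}} = 0`; thus `{K, F}` vanishes as soon as it does on the level set
(`bracket_eq_zero_of_initial`). Hence successive corrections preserve the relations already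
obtained. They also preserve vanishing on `V`: by coisotropy, the Hamiltonian field of a function
that vanishes on `V` is tangent to `V`.

Canonical pairs are built one at a time (`IsCanonicalSystem.exists_extend`). With fewer than `k`
pairs, some conormal covector lies outside the span of the `dp`; corrected, it gives a function `P`
that vanishes on `V` and commutes with the earlier pairs. The rank hypothesis makes `♯` injective on
the conormal space, so the Hamiltonian field of `P` is nonzero and has a time function, which up to
sign is the conjugate variable. Further corrected linear functions `y` complete the coordinates. By
Jacobi, the `{y_i, y_j}` commute with all `q` and `p`, so they depend on `y` alone
(`exists_canonical_chart`). Finally `k` independent functions vanishing on a subspace of codimension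
`k` cut it out locally (`mem_of_vanishing`). -/

noncomputable section

namespace PoissonGeom

open Filter Topology Set

/-! ### Maps smooth near a point; inverse and implicit functions. -/

section Calculus

variable {E F G : Type*} [NormedAddCommGroup E] [NormedSpace ℝ E]
  [NormedAddCommGroup F] [NormedSpace ℝ F] [NormedAddCommGroup G] [NormedSpace ℝ G]

/-- `f` is smooth at all points of some neighbourhood of `x`. -/
def SmoothNear (f : E → F) (x : E) : Prop := ∀ᶠ y in 𝓝 x, ContDiffAt ℝ ∞ f y

namespace SmoothNear

variable {f : E → F} {x : E}

theorem contDiffAt (h : SmoothNear f x) : ContDiffAt ℝ ∞ f x := h.self_of_nhds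

theorem differentiableAt (h : SmoothNear f x) : DifferentiableAt ℝ f x :=
  h.contDiffAt.differentiableAt (by simp)

theorem continuousAt (h : SmoothNear f x) : ContinuousAt f x := h.contDiffAt.continuousAt

theorem hasFDerivAt (h : SmoothNear f x) : HasFDerivAt f (fderiv ℝ f x) x :=
  h.differentiableAt.hasFDerivAt

theorem eventually (h : SmoothNear f x) : ∀ᶠ y in 𝓝 x, SmoothNear f y :=
  h.eventually_nhds

theorem of_contDiff (h : ContDiff ℝ ∞ f) : SmoothNear f x :=
  Eventually.of_forall fun _ ↦ h.contDiffAt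

theorem of_contDiffOn {U : Set E} (hU : IsOpen U) (hx : x ∈ U) (h : ContDiffOn ℝ ∞ f U) :
    SmoothNear f x :=
  (hU.mem_nhds hx |> eventually_mem_set.mpr).mono fun _ hy ↦ h.contDiffAt (hU.mem_nhds hy)

theorem comp {g : F → G} (hg : SmoothNear g (f x)) (hf : SmoothNear f x) :
    SmoothNear (fun y ↦ g (f y)) x := by
  filter_upwards [hf, hf.continuousAt.eventually hg] with y h1 h2 using h2.comp y h1

theorem prodMk {g : E → G} (hf : SmoothNear f x) (hg : SmoothNear g x) :
    SmoothNear (fun y ↦ (f y, g y)) x := by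
  filter_upwards [hf, hg] with y h1 h2 using h1.prodMk h2

theorem fderiv (h : SmoothNear f x) : SmoothNear (fderiv ℝ f) x := by
  filter_upwards [h] with y hy using hy.fderiv_right (by simp)

theorem clm_apply {f : E → F →L[ℝ] G} {g : E → F} (hf : SmoothNear f x) (hg : SmoothNear g x) :
    SmoothNear (fun y ↦ f y (g y)) x := by
  filter_upwards [hf, hg] with y h1 h2 using h1.clm_apply h2

theorem fderiv_apply {X : E → E} (hf : SmoothNear f x) (hX : SmoothNear X x) :
    SmoothNear (fun y ↦ _root_.fderiv ℝ f y (X y)) x := hf.fderiv.clm_apply hX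

theorem add {g : E → F} (hf : SmoothNear f x) (hg : SmoothNear g x) :
    SmoothNear (fun y ↦ f y + g y) x := by
  filter_upwards [hf, hg] with y h1 h2 using h1.add h2

theorem sub {g : E → F} (hf : SmoothNear f x) (hg : SmoothNear g x) :
    SmoothNear (fun y ↦ f y - g y) x := by
  filter_upwards [hf, hg] with y h1 h2 using h1.sub h2

theorem neg (hf : SmoothNear f x) : SmoothNear (fun y ↦ - f y) x := by
  filter_upwards [hf] with y h1 using h1.neg

theorem smul {c : E → ℝ} (hc : SmoothNear c x) (hf : SmoothNear f x) :
    SmoothNear (fun y ↦ c y • f y) x := by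
  filter_upwards [hc, hf] with y h1 h2 using h1.smul h2

theorem sum {ι : Type*} {s : Finset ι} {f : ι → E → F} (h : ∀ i ∈ s, SmoothNear (f i) x) :
    SmoothNear (fun y ↦ ∑ i ∈ s, f i y) x := by
  have := (s.eventually_all).mpr h
  filter_upwards [this] with y hy using ContDiffAt.sum hy

theorem const (c : F) : SmoothNear (fun _ : E ↦ c) x := of_contDiff contDiff_const

theorem id : SmoothNear (fun y : E ↦ y) x := of_contDiff contDiff_id

theorem clm (L : E →L[ℝ] F) : SmoothNear L x := of_contDiff L.contDiff

/-- A function that is smooth near a point agrees near this point with a smooth function. -/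
theorem exists_contDiff [HasContDiffBump E] (h : SmoothNear f x) :
    ∃ g : E → F, ContDiff ℝ ∞ g ∧ g =ᶠ[𝓝 x] f := by
  obtain ⟨ε, hε, hball⟩ := Metric.eventually_nhds_iff_ball.mp h
  -- The support is the closed ball of radius `ε / 2`, strictly inside the ball where `f` is smooth,
  -- so the extension by zero is smooth everywhere.
  let χ : ContDiffBump x := ⟨ε / 4, ε / 2, by positivity, by linarith⟩
  refine ⟨fun y ↦ χ y • f y, contDiff_iff_contDiffAt.mpr fun y ↦ ?_, ?_⟩
  · by_cases hy : y ∈ Metric.ball x ε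
    · exact χ.contDiff.contDiffAt.smul (hball y hy)
    · have : y ∉ tsupport χ := by
        rw [χ.tsupport_eq, Metric.mem_closedBall]
        rw [Metric.mem_ball] at hy
        change ¬ dist y x ≤ ε / 2
        linarith
      have h0 : (fun z ↦ χ z • f z) =ᶠ[𝓝 y] fun _ ↦ 0 := by
        filter_upwards [notMem_tsupport_iff_eventuallyEq.mp this] with z hz
        simp [hz]
      exact contDiffAt_const.congr_of_eventuallyEq h0
  · filter_upwards [χ.eventuallyEq_one] with z hz
    simp [hz]

/-- The inverse function theorem for functions that are smooth near a point. -/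
theorem exists_openPartialHomeomorph [CompleteSpace E] (h : SmoothNear f x) (e : E ≃L[ℝ] F)
    (he : (e : E →L[ℝ] F) = _root_.fderiv ℝ f x) :
    ∃ Φ : OpenPartialHomeomorph E F, ⇑Φ = f ∧ x ∈ Φ.source ∧ ContDiffOn ℝ ∞ f Φ.source ∧
      ContDiffOn ℝ ∞ Φ.symm Φ.target := by
  have hd : HasFDerivAt f (e : E →L[ℝ] F) x := he ▸ h.hasFDerivAt
  let Φ := h.contDiffAt.toOpenPartialHomeomorph f hd (by simp)
  -- Invertible operators form an open set; on a smaller source all derivatives are invertible,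
  -- which makes the inverse smooth on the whole target and not only at `f x`.
  have hinv : ∀ᶠ y in 𝓝 x, _root_.fderiv ℝ f y ∈
      range (ContinuousLinearEquiv.toContinuousLinearMap : (E ≃L[ℝ] F) → E →L[ℝ] F) :=
    h.fderiv.continuousAt.eventually (he ▸ e.nhds)
  obtain ⟨U, hU, hUo, hxU⟩ := eventually_nhds_iff.mp (h.and hinv)
  refine ⟨Φ.restrOpen U hUo, rfl, ⟨h.contDiffAt.mem_toOpenPartialHomeomorph_source hd (by simp),
    hxU⟩, fun y hy ↦ (hU y hy.2).1.contDiffWithinAt, fun z hz ↦ ?_⟩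
  have hs := (Φ.restrOpen U hUo).map_target hz
  obtain ⟨e', he'⟩ := (hU _ hs.2).2
  refine ((Φ.restrOpen U hUo).contDiffAt_symm hz (f₀' := e') ?_ (hU _ hs.2).1).contDiffWithinAt
  rw [he']
  exact ((hU _ hs.2).1.differentiableAt (by simp)).hasFDerivAt

end SmoothNear

/-- A smooth implicit function theorem. -/
theorem exists_smooth_implicit [CompleteSpace E] [CompleteSpace F] {Φ : E × F → G}
    {a : E} {b : F} (h : SmoothNear Φ (a, b)) (e : F ≃L[ℝ] G)
    (he : ∀ v, fderiv ℝ Φ (a, b) (0, v) = e v) :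
    ∃ ψ : E → F, SmoothNear ψ a ∧ ψ a = b ∧ (∀ᶠ x in 𝓝 a, Φ (x, ψ x) = Φ (a, b)) ∧
      ∀ᶠ z : E × F in 𝓝 (a, b), Φ z = Φ (a, b) → ψ z.1 = z.2 := by
  have hs : SmoothNear (fun z : E × F ↦ (z.1, Φ z)) (a, b) :=
    (SmoothNear.of_contDiff contDiff_fst).prodMk h
  set A := fderiv ℝ Φ (a, b) with hA
  have hA2 : ∀ u v, A (u, v) = A (u, 0) + e v := fun u v ↦ by
    rw [← he, ← map_add]; simp
  have hder : HasFDerivAt (fun z : E × F ↦ (z.1, Φ z)) ((ContinuousLinearMap.fst ℝ E F).prod A)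
    (a, b) := hasFDerivAt_fst.prodMk h.hasFDerivAt
  -- The derivative of `(x, v) ↦ (x, Φ (x, v))` is block triangular, with inverse `(u, w) ↦ (u, e⁻¹
  -- (w - A (u, 0)))`.
  let L : (E × F) ≃L[ℝ] (E × G) := ContinuousLinearEquiv.equivOfInverse
    ((ContinuousLinearMap.fst ℝ E F).prod A)
    ((ContinuousLinearMap.fst ℝ E G).prod ((e.symm : G →L[ℝ] F) ∘L
      (ContinuousLinearMap.snd ℝ E G - A ∘L ContinuousLinearMap.inl ℝ E F ∘L
        ContinuousLinearMap.fst ℝ E G)))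
    (fun z ↦ by
      obtain ⟨u, v⟩ := z
      simp [hA2 u v])
    (fun z ↦ by
      obtain ⟨u, v⟩ := z
      simp only [ContinuousLinearMap.prod_apply, ContinuousLinearMap.coe_fst', Prod.mk.injEq,
        true_and]
      rw [hA2]
      simp)
  obtain ⟨Ψ, hΨ, hmem, -, hsymm⟩ := hs.exists_openPartialHomeomorph L (by rw [hder.fderiv]; rfl)
  have hΨab : Ψ (a, b) = (a, Φ (a, b)) := by rw [hΨ]
  have htgt : (a, Φ (a, b)) ∈ Ψ.target := hΨab ▸ Ψ.map_source hmem
  have hsm : SmoothNear Ψ.symm (a, Φ (a, b)) := .of_contDiffOn Ψ.open_target htgt hsymm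
  have hsl : SmoothNear (fun x : E ↦ (x, Φ (a, b))) a := SmoothNear.id.prodMk (.const _)
  refine ⟨fun x ↦ (Ψ.symm (x, Φ (a, b))).2, ?_, ?_, ?_, ?_⟩
  · exact (SmoothNear.of_contDiff contDiff_snd).comp (SmoothNear.comp hsm hsl)
  · change (Ψ.symm (a, Φ (a, b))).2 = b
    rw [← hΨab, Ψ.left_inv hmem]
  · filter_upwards [hsl.continuousAt.eventually (Ψ.open_target.mem_nhds htgt)] with x hx
    have := Ψ.right_inv hx
    rw [hΨ] at this
    simp only [Prod.mk.injEq] at this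
    rw [← this.2]
    exact congrArg Φ (Prod.ext this.1.symm (by rw [this.2]))
  · filter_upwards [Ψ.open_source.mem_nhds hmem] with z hz hΦ
    have := Ψ.left_inv hz
    rw [hΨ] at this
    simp only [hΦ] at this
    rw [this]

end Calculus

/-! ### Smoothness of `u ↦ X ∘ u` on spaces of continuous curves. -/

section Superposition

universe u v

variable {K : Type v} [TopologicalSpace K] [CompactSpace K]

/-- Pointwise application of a family of linear maps, as a continuous bilinear map. -/
def pointwiseApply (K : Type v) [TopologicalSpace K] [CompactSpace K] (E F : Type u)
    [NormedAddCommGroup E] [NormedSpace ℝ E] [NormedAddCommGroup F] [NormedSpace ℝ F] :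
    C(K, E →L[ℝ] F) →L[ℝ] C(K, E) →L[ℝ] C(K, F) :=
  LinearMap.mkContinuous₂
    (LinearMap.mk₂ ℝ (fun A v ↦ ⟨fun t ↦ A t (v t), by fun_prop⟩)
      (fun _ _ _ ↦ by ext; simp) (fun _ _ _ ↦ by ext; simp)
      (fun _ _ _ ↦ by ext; simp) (fun _ _ _ ↦ by ext; simp)) 1
    (fun A v ↦ by
      rw [ContinuousMap.norm_le _ (by positivity)]
      intro t
      rw [one_mul]
      exact (A t).le_of_opNorm_le_of_le (A.norm_coe_le_norm t) (v.norm_coe_le_norm t))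

variable {E F : Type u} [NormedAddCommGroup E] [NormedSpace ℝ E] [NormedAddCommGroup F]
  [NormedSpace ℝ F]

/-- The range of `u` is compact, so `X'` is uniformly continuous along it and the mean value
inequality bounds the remainder uniformly in the parameter. -/
theorem hasFDerivAt_superposition {X : C(E, F)} {X' : C(E, E →L[ℝ] F)}
    (h : ∀ x, HasFDerivAt X (X' x) x) (u : C(K, E)) :
    HasFDerivAt (fun u : C(K, E) ↦ X.comp u) (pointwiseApply K E F (X'.comp u)) u := by
  rw [hasFDerivAt_iff_isLittleO_nhds_zero, Asymptotics.isLittleO_iff]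
  intro ε hε
  have hc : IsCompact (range u) := isCompact_range u.continuous
  have hu := hc.uniformContinuousAt_of_continuousAt X' (fun _ _ ↦ X'.continuous.continuousAt)
    (Metric.dist_mem_uniformity hε)
  obtain ⟨δ, hδ, hδu⟩ := Metric.mem_uniformity_dist.mp hu
  filter_upwards [Metric.ball_mem_nhds 0 hδ] with v hv
  rw [mem_ball_zero_iff] at hv
  rw [ContinuousMap.norm_le _ (by positivity)]
  intro t
  have key := (convex_ball (u t) δ).norm_image_sub_le_of_norm_hasFDerivWithin_le'
    (f := X) (f' := X') (φ := X' (u t)) (C := ε) (x := u t) (y := u t + v t)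
    (fun x _ ↦ (h x).hasFDerivWithinAt)
    (fun x hx ↦ by
      have := hδu (a := u t) (b := x) (by rw [dist_comm]; exact hx) (mem_range_self t)
      rw [← dist_eq_norm, dist_comm]
      exact this.le)
    (Metric.mem_ball_self hδ)
    (by rw [Metric.mem_ball, dist_self_add_left]; exact (v.norm_coe_le_norm t).trans_lt hv)
  simp only [add_sub_cancel_left] at key
  exact key.trans (mul_le_mul_of_nonneg_left (v.norm_coe_le_norm t) hε.le)

/-- The derivative of superposition by `X` is, up to the bilinear map `pointwiseApply`,
superposition by `fderiv ℝ X`. The induction therefore changes the target from `F` to `E →L[ℝ] F`,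
which is why both spaces share a universe. -/
theorem contDiff_superposition_nat (n : ℕ) : ∀ {F : Type u} [NormedAddCommGroup F]
    [NormedSpace ℝ F] (X : C(E, F)), ContDiff ℝ n X →
    ContDiff ℝ n (fun u : C(K, E) ↦ X.comp u) := by
  induction n with
  | zero =>
    intro F _ _ X _
    exact contDiff_zero.mpr (ContinuousMap.continuous_postcomp X)
  | succ n ih =>
    intro F _ _ X hX
    have hX' := contDiff_succ_iff_fderiv.mp (by exact_mod_cast hX : ContDiff ℝ ((n : ℕ∞ω) + 1) X)
    let X' : C(E, E →L[ℝ] F) := ⟨fderiv ℝ X, hX'.2.2.continuous⟩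
    have hd := fun u : C(K, E) ↦ hasFDerivAt_superposition (X := X) (X' := X')
      (fun x ↦ (hX'.1 x).hasFDerivAt) u
    push_cast
    refine contDiff_succ_iff_fderiv.mpr ⟨fun u ↦ (hd u).differentiableAt, by simp, ?_⟩
    rw [show fderiv ℝ (fun u : C(K, E) ↦ X.comp u) =
      fun u ↦ pointwiseApply K E F (X'.comp u) from funext fun u ↦ (hd u).fderiv]
    exact (pointwiseApply K E F).contDiff.comp (ih X' hX'.2.2)

/-- The superposition operator defined by a smooth map on a space of continuous functions is
smooth. -/
theorem contDiff_superposition (X : C(E, F)) (hX : ContDiff ℝ ∞ X) :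
    ContDiff ℝ ∞ (fun u : C(K, E) ↦ X.comp u) :=
  contDiff_infty.mpr fun n ↦ contDiff_superposition_nat n X (contDiff_infty.mp hX n)

end Superposition

/-! ### The integral operator on curves. -/

section Flow

variable {E : Type*} [NormedAddCommGroup E] [NormedSpace ℝ E]

/-- The primitive vanishing at `0`, as an operator on the continuous functions on `[-1, 1]`. -/
def primitiveCLM (E : Type*) [NormedAddCommGroup E] [NormedSpace ℝ E] :
    C(Icc (-1 : ℝ) 1, E) →L[ℝ] C(Icc (-1 : ℝ) 1, E) :=
  LinearMap.mkContinuous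
    { toFun := fun v ↦ ⟨fun s ↦ ∫ r in (0 : ℝ)..s, v (projIcc (-1) 1 (by norm_num) r), by
        have : Continuous fun r : ℝ ↦ v (projIcc (-1) 1 (by norm_num) r) :=
          v.continuous.comp continuous_projIcc
        exact (intervalIntegral.continuous_primitive
          (fun a b ↦ this.intervalIntegrable a b) 0).comp continuous_subtype_val⟩
      map_add' := fun v w ↦ by
        ext s
        exact intervalIntegral.integral_add
          ((v.continuous.comp continuous_projIcc).intervalIntegrable _ _)
          ((w.continuous.comp continuous_projIcc).intervalIntegrable _ _)
      map_smul' := fun c v ↦ by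
        ext s
        exact intervalIntegral.integral_smul c _ } 1
    (fun v ↦ by
      rw [ContinuousMap.norm_le _ (by positivity)]
      intro s
      have := intervalIntegral.norm_integral_le_of_norm_le_const
        (f := fun r ↦ v (projIcc (-1) 1 (by norm_num) r)) (a := 0) (b := s) (C := ‖v‖)
        (fun r _ ↦ v.norm_coe_le_norm _)
      refine this.trans ?_
      rw [mul_comm]
      gcongr
      rw [sub_zero]
      exact abs_le.mpr s.2)

theorem primitiveCLM_apply (v : C(Icc (-1 : ℝ) 1, E)) (s : Icc (-1 : ℝ) 1) :
    primitiveCLM E v s = ∫ r in (0 : ℝ)..s, v (projIcc (-1) 1 (by norm_num) r) := rfl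

end Flow

/-! ### Smooth local flows, by the implicit function theorem on a space of curves. -/

section Flow

variable {E : Type*} [NormedAddCommGroup E] [NormedSpace ℝ E]

/-- The curve `s' ↦ u (s s')`. -/
def rescaleCurve (u : C(Icc (-1 : ℝ) 1, E)) (s : Icc (-1 : ℝ) 1) : C(Icc (-1 : ℝ) 1, E) :=
  u.comp ⟨fun r ↦ ⟨s * r, by
    have := mul_le_mul (abs_le.mpr s.2) (abs_le.mpr r.2) (abs_nonneg _) zero_le_one
    rw [← abs_mul, one_mul] at this
    exact abs_le.mp this⟩, by fun_prop⟩

/-- The substitution `x ↦ s x` in the integral. It makes the rescaled solution for time `t` a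
solution for time `s t`. -/
theorem primitiveCLM_rescaleCurve (u : C(Icc (-1 : ℝ) 1, E)) (s : Icc (-1 : ℝ) 1) :
    (s : ℝ) • primitiveCLM E (rescaleCurve u s) = rescaleCurve (primitiveCLM E u) s := by
  ext r
  rw [ContinuousMap.smul_apply, primitiveCLM_apply]
  have h1 : (∫ x in (0 : ℝ)..r, rescaleCurve u s (projIcc (-1) 1 (by norm_num) x)) =
      ∫ x in (0 : ℝ)..r, u (projIcc (-1) 1 (by norm_num) (s * x)) := by
    refine intervalIntegral.integral_congr fun x hx ↦ ?_
    have hx' : x ∈ Icc (-1 : ℝ) 1 :=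
      (ordConnected_Icc.uIcc_subset (by simp) r.2) hx
    have hsx : (s : ℝ) * x ∈ Icc (-1 : ℝ) 1 := by
      have := mul_le_mul (abs_le.mpr s.2) (abs_le.mpr hx') (abs_nonneg _) zero_le_one
      rw [← abs_mul, one_mul] at this
      exact abs_le.mp this
    simp only [rescaleCurve, ContinuousMap.comp_apply, ContinuousMap.coe_mk]
    rw [projIcc_of_mem _ hx', projIcc_of_mem _ hsx]
  rw [h1, intervalIntegral.smul_integral_comp_mul_left
    (fun x ↦ u (projIcc (-1) 1 (by norm_num) x)) (s : ℝ), mul_zero]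
  rfl

/-- A smooth vector field has a smooth local flow. -/
theorem exists_smooth_flow [FiniteDimensional ℝ E] {X : E → E} {x₀ : E} (hX : SmoothNear X x₀) :
    ∃ φ : ℝ × E → E, SmoothNear φ (0, x₀) ∧ (∀ᶠ x in 𝓝 x₀, φ (0, x) = x) ∧
      ∀ᶠ p in 𝓝 ((0 : ℝ), x₀), HasDerivAt (fun t ↦ φ (t, p.2)) (X (φ p)) p.1 := by
  have : CompleteSpace E := FiniteDimensional.complete ℝ E
  obtain ⟨Y, hY, hYX⟩ := hX.exists_contDiff
  let Yc : C(E, E) := ⟨Y, hY.continuous⟩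
  let c : E →L[ℝ] C(Icc (-1 : ℝ) 1, E) := ContinuousLinearMap.const ℝ _
  -- A zero of `Φ` is a curve `u` with `u s = x + t ∫₀ˢ Y(u)`, that is, the solution starting at
  -- `x`, run at speed `t`. Time thus becomes a parameter of the implicit function theorem. At `t =
  -- 0` the equation is affine in `u`, with derivative the identity.
  let Φ : (ℝ × E) × C(Icc (-1 : ℝ) 1, E) → C(Icc (-1 : ℝ) 1, E) :=
    fun z ↦ z.2 - c z.1.2 - z.1.1 • primitiveCLM E (Yc.comp z.2)
  have hΦ : ContDiff ℝ ∞ Φ := by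
    refine (contDiff_snd.sub (c.contDiff.comp (contDiff_snd.comp contDiff_fst))).sub
      ((contDiff_fst.comp contDiff_fst).smul ((primitiveCLM E).contDiff.comp ?_))
    exact (contDiff_superposition Yc hY).comp contDiff_snd
  have h0 : Φ ((0, x₀), c x₀) = 0 := by simp [Φ]
  have hder : ∀ v, fderiv ℝ Φ ((0, x₀), c x₀) (0, v) = ContinuousLinearEquiv.refl ℝ _ v := by
    intro v
    have h1 : HasFDerivAt (fun u ↦ Φ ((0, x₀), u))
        (fderiv ℝ Φ ((0, x₀), c x₀) ∘L ContinuousLinearMap.inr ℝ _ _) (c x₀) :=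
      HasFDerivAt.comp (c x₀) (hΦ.differentiable (by simp) _).hasFDerivAt
        (hasFDerivAt_prodMk_right _ _)
    have h2 : HasFDerivAt (fun u ↦ Φ ((0, x₀), u)) (ContinuousLinearMap.id ℝ _) (c x₀) := by
      simp only [Φ, zero_smul, sub_zero]
      exact (hasFDerivAt_id _).sub_const _
    simpa using DFunLike.congr_fun (h1.unique h2) v
  obtain ⟨ψ, hψ, hψ0, hsol, huniq⟩ := exists_smooth_implicit (Φ := Φ) (.of_contDiff hΦ) _ hder
  rw [h0] at hsol huniq
  let one : Icc (-1 : ℝ) 1 := ⟨1, by norm_num⟩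
  obtain ⟨ε, hε, huniq⟩ := Metric.eventually_nhds_iff.mp huniq
  -- Uniqueness of the implicit solution identifies the rescaled curve with the solution for the
  -- rescaled time.
  have hrep : ∀ᶠ p in 𝓝 ((0 : ℝ), x₀), Φ (p, ψ p) = 0 ∧
      ∀ s : Icc (-1 : ℝ) 1, ψ (s * p.1, p.2) one = ψ p s := by
    have hc := hψ.continuousAt
    rw [ContinuousAt, hψ0] at hc
    filter_upwards [hsol, Metric.ball_mem_nhds _ hε, hc.eventually (Metric.ball_mem_nhds _ hε)]
      with p h1 h2 h3
    refine ⟨h1, fun s ↦ ?_⟩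
    have key := @huniq ((s * p.1, p.2), rescaleCurve (ψ p) s) ?_ ?_
    · rw [key]
      simp [rescaleCurve, one]
    · rw [Prod.dist_eq, Prod.dist_eq]
      rw [Metric.mem_ball, Prod.dist_eq] at h2
      refine max_lt (max_lt ?_ ((le_max_right _ _).trans_lt h2)) ?_
      · refine lt_of_le_of_lt ?_ ((le_max_left _ _).trans_lt h2)
        simp only [Real.dist_eq, sub_zero, abs_mul]
        exact mul_le_of_le_one_left (abs_nonneg _) (abs_le.mpr s.2)
      · refine lt_of_le_of_lt ?_ h3
        rw [ContinuousMap.dist_le dist_nonneg]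
        intro r
        exact ContinuousMap.dist_apply_le_dist (f := ψ p) (g := c x₀) _
    · have : Φ ((s * p.1, p.2), rescaleCurve (ψ p) s) = rescaleCurve (Φ (p, ψ p)) s := by
        have h4 := primitiveCLM_rescaleCurve (Yc.comp (ψ p)) s
        have h5 : Yc.comp (rescaleCurve (ψ p) s) = rescaleCurve (Yc.comp (ψ p)) s := rfl
        simp only [Φ, h5]
        rw [mul_comm, mul_smul, h4]
        rfl
      rw [this, h1]
      rfl
  have hsm : SmoothNear (fun p ↦ ψ p one) (0, x₀) :=
    SmoothNear.comp (g := ContinuousMap.evalCLM ℝ one) (.clm _) hψ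
  have hinit : ∀ᶠ x in 𝓝 x₀, ψ (0, x) one = x := by
    have hcont : ContinuousAt (fun x : E ↦ ((0 : ℝ), x)) x₀ := by fun_prop
    filter_upwards [hcont.eventually hsol] with x hx
    simp only [Φ, zero_smul, sub_zero, sub_eq_zero] at hx
    rw [hx]
    rfl
  obtain ⟨δ, hδ, hball⟩ := Metric.eventually_nhds_iff.mp hrep
  have hX' : ∀ᶠ p in 𝓝 ((0 : ℝ), x₀), Y (ψ p one) = X (ψ p one) := by
    have h1 : ψ (0, x₀) one = x₀ := by rw [hψ0]; rfl
    have h2 : Tendsto (fun p ↦ ψ p one) (𝓝 (0, x₀)) (𝓝 x₀) := by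
      simpa only [h1] using hsm.continuousAt.tendsto
    exact h2.eventually hYX
  have hflow : ∀ᶠ p in 𝓝 ((0 : ℝ), x₀), HasDerivAt (fun t ↦ ψ (t, p.2) one) (X (ψ p one)) p.1 := by
    filter_upwards [hX', Metric.ball_mem_nhds _ (half_pos hδ)] with p h1 h2
    obtain ⟨t, x⟩ := p
    rw [Metric.mem_ball, Prod.dist_eq, max_lt_iff, Real.dist_eq, sub_zero] at h2
    obtain ⟨ht, hx⟩ := h2
    simp only at ht hx
    have hδ2 : (0 : ℝ) < δ / 2 := half_pos hδ
    have hgood := @hball (δ / 2, x) (by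
      rw [Prod.dist_eq, max_lt_iff, Real.dist_eq, sub_zero, abs_of_pos hδ2]
      exact ⟨half_lt_self hδ, hx.trans (half_lt_self hδ)⟩)
    -- All times `|r| < δ / 2` are read off the single curve `ψ (δ / 2, x)`, so the dependence on
    -- `r` is only in the upper limit and the fundamental theorem of calculus applies.
    have hform : ∀ r : ℝ, |r| < δ / 2 → ψ (r, x) one = x + (δ / 2) • ∫ y in (0 : ℝ)..(r / (δ / 2)),
        Y (ψ (δ / 2, x) (projIcc (-1) 1 (by norm_num) y)) := by
      intro r hr
      have hr' : r / (δ / 2) ∈ Icc (-1 : ℝ) 1 := by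
        rw [mem_Icc, ← abs_le, abs_div, abs_of_pos hδ2, div_le_one hδ2]
        exact hr.le
      have e1 := hgood.2 ⟨r / (δ / 2), hr'⟩
      rw [div_mul_cancel₀ _ hδ2.ne'] at e1
      have e2 := congrArg (fun u ↦ u ⟨r / (δ / 2), hr'⟩) hgood.1
      simp only [Φ, ContinuousMap.sub_apply, ContinuousMap.zero_apply, sub_sub, sub_eq_zero] at e2
      rw [e1, e2]
      rfl
    have hnear : ∀ᶠ r in 𝓝 t, ψ (r, x) one = x + (δ / 2) • ∫ y in (0 : ℝ)..(r / (δ / 2)),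
        Y (ψ (δ / 2, x) (projIcc (-1) 1 (by norm_num) y)) := by
      filter_upwards [(continuous_abs.tendsto t).eventually (gt_mem_nhds ht)] with r hr
        using hform r hr
    have ht' : t / (δ / 2) ∈ Icc (-1 : ℝ) 1 := by
      rw [mem_Icc, ← abs_le, abs_div, abs_of_pos hδ2, div_le_one hδ2]
      exact ht.le
    have hcont : Continuous fun y ↦ Y (ψ (δ / 2, x) (projIcc (-1) 1 (by norm_num) y)) :=
      hY.continuous.comp ((ψ (δ / 2, x)).continuous.comp continuous_projIcc)
    have hd := ((hcont.integral_hasStrictDerivAt 0 (t / (δ / 2))).hasDerivAt.scomp t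
      ((hasDerivAt_id t).div_const (δ / 2))).const_smul (δ / 2) |>.const_add x
    refine (hd.congr_of_eventuallyEq hnear).congr_deriv ?_
    rw [smul_smul, mul_one_div_cancel hδ2.ne', one_smul, projIcc_of_mem _ ht',
      ← hgood.2 ⟨t / (δ / 2), ht'⟩, div_mul_cancel₀ _ hδ2.ne']
    exact h1
  exact ⟨fun p ↦ ψ p one, hsm, hinit, hflow⟩

/-- The local flow of a smooth vector field preserves the vector field. -/
theorem exists_smooth_flow_fderiv [FiniteDimensional ℝ E] {X : E → E} {x₀ : E}
    (hX : SmoothNear X x₀) :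
    ∃ φ : ℝ × E → E, SmoothNear φ (0, x₀) ∧ (∀ᶠ x in 𝓝 x₀, φ (0, x) = x) ∧
      (∀ᶠ p in 𝓝 ((0 : ℝ), x₀), fderiv ℝ φ p (1, 0) = X (φ p)) ∧
      ∀ᶠ p in 𝓝 ((0 : ℝ), x₀), fderiv ℝ φ p (0, X p.2) = X (φ p) := by
  obtain ⟨φ, hφ, hinit, hflow⟩ := exists_smooth_flow hX
  have hφ0 : Tendsto φ (𝓝 ((0 : ℝ), x₀)) (𝓝 x₀) := by
    have := hφ.continuousAt.tendsto
    rwa [hinit.self_of_nhds] at this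
  refine ⟨φ, hφ, hinit, ?_, ?_⟩
  · filter_upwards [hφ, hflow] with p h1 h2
    have h3 : HasDerivAt (fun t : ℝ ↦ (t, p.2)) (1, 0) p.1 :=
      (hasDerivAt_id p.1).prodMk (hasDerivAt_const p.1 p.2)
    exact ((h1.differentiableAt (by simp)).hasFDerivAt.comp_hasDerivAt p.1 h3).unique h2
  obtain ⟨K, S, hS, hlip⟩ := (hX.contDiffAt.of_le (by simp : (1 : ℕ∞ω) ≤ ∞)).exists_lipschitzOnWith
  have hsnd : Tendsto (Prod.snd : ℝ × E → E) (𝓝 (0, x₀)) (𝓝 x₀) := continuous_snd.tendsto _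
  obtain ⟨r, hr, hball⟩ := Metric.eventually_nhds_iff.mp
    ((hflow.and (hφ0.eventually hS)).and (hsnd.eventually hinit))
  obtain ⟨d, hd, hball'⟩ := Metric.eventually_nhds_iff.mp
    (hφ0.eventually (Metric.ball_mem_nhds x₀ hr))
  obtain ⟨δ, hδ, hδr, hδd⟩ : ∃ δ > 0, 2 * δ ≤ r ∧ δ ≤ d :=
    ⟨min (r / 2) d, by positivity, by linarith [min_le_left (r / 2) d], min_le_right _ _⟩
  -- Both sides solve the same Lipschitz equation in `t` and agree at `t = 0`. The derivative of
  -- this group law in `s` at `0` is the invariance of `X`.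
  have hgroup : ∀ t ∈ Ioo (-δ) δ, ∀ s ∈ Ioo (-δ) δ, ∀ x ∈ Metric.ball x₀ δ,
      φ (t, φ (s, x)) = φ (t + s, x) := by
    intro t ht s hs x hx
    have hy : dist (φ (s, x)) x₀ < r := hball' (by
      rw [Prod.dist_eq, max_lt_iff, Real.dist_eq, sub_zero]
      exact ⟨(abs_lt.mpr hs).trans_le hδd, lt_of_lt_of_le hx hδd⟩)
    refine ODE_solution_unique_of_mem_Ioo (v := fun _ ↦ X) (s := fun _ ↦ S) (K := K) (a := -δ)
      (b := δ) (t₀ := 0) (f := fun t ↦ φ (t, φ (s, x))) (g := fun t ↦ φ (t + s, x))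
      (fun _ _ ↦ hlip) ⟨by linarith, hδ⟩ ?_ ?_ ?_ ht
    · intro t ht
      refine (@hball (t, φ (s, x)) ?_).1
      rw [Prod.dist_eq, max_lt_iff, Real.dist_eq, sub_zero]
      exact ⟨(abs_lt.mpr ht).trans_le (by linarith), hy⟩
    · intro t ht
      have := (@hball (t + s, x) (by
        rw [Prod.dist_eq, max_lt_iff, Real.dist_eq, sub_zero]
        exact ⟨abs_lt.mpr ⟨by linarith [ht.1, hs.1], by linarith [ht.2, hs.2]⟩,
          lt_of_lt_of_le hx (by linarith)⟩)).1
      exact ⟨HasDerivAt.comp_add_const t s this.1, this.2⟩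
    · simp only [zero_add]
      exact (@hball (s, φ (s, x)) (by
        rw [Prod.dist_eq, max_lt_iff, Real.dist_eq, sub_zero]
        exact ⟨(abs_lt.mpr hs).trans_le (by linarith), hy⟩)).2
  filter_upwards [hφ, hflow, hsnd.eventually hinit, Metric.ball_mem_nhds _ hδ,
    ((continuous_const.prodMk continuous_snd).tendsto' ((0 : ℝ), x₀) ((0 : ℝ), x₀) rfl).eventually
      hflow] with p h1 h2 h3 h4 h5
  obtain ⟨t, x⟩ := p
  rw [Metric.mem_ball, Prod.dist_eq, max_lt_iff, Real.dist_eq, sub_zero] at h4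
  simp only at h2 h3 h4 h5 ⊢
  have hl : HasDerivAt (fun s ↦ φ (t, φ (s, x))) (fderiv ℝ φ (t, x) (0, X x)) 0 := by
    have hin : HasDerivAt (fun s : ℝ ↦ (t, φ (s, x))) (0, X x) 0 := by
      rw [h3] at h5
      exact (hasDerivAt_const 0 t).prodMk h5
    refine HasFDerivAt.comp_hasDerivAt_of_eq (0 : ℝ) ?_ hin rfl
    rw [h3]
    exact (h1.differentiableAt (by simp)).hasFDerivAt
  have hr' : HasDerivAt (fun s ↦ φ (t + s, x)) (X (φ (t, x))) 0 :=
    HasDerivAt.comp_const_add t 0 (by simpa using h2)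
  refine (hl.congr_of_eventuallyEq ?_).unique hr'
  filter_upwards [Ioo_mem_nhds (neg_neg_of_pos hδ) hδ] with s hs
  exact (hgroup t (abs_lt.mp h4.1) s hs x h4.2).symm

end Flow

/-! ### The Cauchy problem for a vector field transverse to a hypersurface. -/

section Cauchy

variable {E : Type*} [NormedAddCommGroup E] [NormedSpace ℝ E]

theorem fderiv_comp_eq {F G : Type*} [NormedAddCommGroup F] [NormedSpace ℝ F]
    [NormedAddCommGroup G] [NormedSpace ℝ G] {g : F → G} {f : E → F} {x : E}
    (hg : DifferentiableAt ℝ g (f x)) (hf : DifferentiableAt ℝ f x) (v : E) :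
    fderiv ℝ (fun y ↦ g (f y)) x v = fderiv ℝ g (f x) (fderiv ℝ f x v) :=
  DFunLike.congr_fun (fderiv_comp x hg hf) v

/-- `φ` is a local flow of the vector field `X` near `x₀`, and `τ x` is the time that the flow
needs to come to `x` from the hypersurface `h = h x₀`. -/
structure IsFlowBox (X : E → E) (h : E → ℝ) (x₀ : E) (φ : ℝ × E → E) (τ : E → ℝ) : Prop where
  flow_smooth : SmoothNear φ (0, x₀)
  flow_zero : ∀ᶠ x in 𝓝 x₀, φ (0, x) = x
  fderiv_flow_fst : ∀ᶠ p in 𝓝 ((0 : ℝ), x₀), fderiv ℝ φ p (1, 0) = X (φ p)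
  fderiv_flow_snd : ∀ᶠ p in 𝓝 ((0 : ℝ), x₀), fderiv ℝ φ p (0, X p.2) = X (φ p)
  time_smooth : SmoothNear τ x₀
  time_self : τ x₀ = 0
  apply_return : ∀ᶠ x in 𝓝 x₀, h (φ (-τ x, x)) = h x₀
  time_eq_zero : ∀ᶠ x in 𝓝 x₀, h x = h x₀ → τ x = 0

namespace IsFlowBox

variable {X : E → E} {h : E → ℝ} {x₀ : E} {φ : ℝ × E → E} {τ : E → ℝ}

theorem returnArg_smooth (H : IsFlowBox X h x₀ φ τ) : SmoothNear (fun x ↦ (-τ x, x)) x₀ :=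
  H.time_smooth.neg.prodMk .id

theorem tendsto_returnArg (H : IsFlowBox X h x₀ φ τ) :
    Tendsto (fun x ↦ (-τ x, x)) (𝓝 x₀) (𝓝 (0, x₀)) := by
  simpa [H.time_self] using H.returnArg_smooth.continuousAt.tendsto

theorem flow_self (H : IsFlowBox X h x₀ φ τ) : φ (0, x₀) = x₀ := H.flow_zero.self_of_nhds

theorem tendsto_flow (H : IsFlowBox X h x₀ φ τ) : Tendsto φ (𝓝 (0, x₀)) (𝓝 x₀) := by
  simpa only [H.flow_self] using H.flow_smooth.continuousAt.tendsto

theorem tendsto_return (H : IsFlowBox X h x₀ φ τ) :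
    Tendsto (fun x ↦ φ (-τ x, x)) (𝓝 x₀) (𝓝 x₀) := H.tendsto_flow.comp H.tendsto_returnArg

theorem return_self (H : IsFlowBox X h x₀ φ τ) : φ (-τ x₀, x₀) = x₀ := by
  rw [H.time_self, neg_zero, H.flow_self]

theorem return_smooth (H : IsFlowBox X h x₀ φ τ) : SmoothNear (fun x ↦ φ (-τ x, x)) x₀ := by
  refine SmoothNear.comp (g := φ) ?_ H.returnArg_smooth
  simpa [H.time_self] using H.flow_smooth

theorem fderiv_return (H : IsFlowBox X h x₀ φ τ) : ∀ᶠ x in 𝓝 x₀, ∀ v,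
    fderiv ℝ (fun x ↦ φ (-τ x, x)) x v = fderiv ℝ φ (-τ x, x) (-fderiv ℝ τ x v, v) := by
  filter_upwards [H.tendsto_returnArg.eventually H.flow_smooth, H.time_smooth] with x h1 h2 v
  have h3 : HasFDerivAt (fun x ↦ (-τ x, x))
      ((-fderiv ℝ τ x).prod (ContinuousLinearMap.id ℝ E)) x :=
    (h2.differentiableAt (by simp)).hasFDerivAt.neg.prodMk (hasFDerivAt_id x)
  rw [fderiv_comp_eq (g := φ) (f := fun x ↦ (-τ x, x)) (h1.differentiableAt (by simp))
    h3.differentiableAt, h3.fderiv]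
  rfl

/-- Moving `x` along `X` and changing the return time both displace the return point along `X`; once
the time is known to grow at rate `1`, the return map is constant along `X`. -/
theorem fderiv_return_field (H : IsFlowBox X h x₀ φ τ) : ∀ᶠ x in 𝓝 x₀,
    fderiv ℝ (fun x ↦ φ (-τ x, x)) x (X x) =
      (1 - fderiv ℝ τ x (X x)) • X (φ (-τ x, x)) := by
  filter_upwards [H.fderiv_return, H.tendsto_returnArg.eventually H.fderiv_flow_fst,
    H.tendsto_returnArg.eventually H.fderiv_flow_snd] with x h1 h2 h3
  rw [h1, sub_smul, one_smul]
  have : ((-fderiv ℝ τ x (X x), X x) : ℝ × E) =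
      (0, X x) - fderiv ℝ τ x (X x) • ((1 : ℝ), (0 : E)) := by simp
  rw [this, map_sub, map_smul, h2, h3]

theorem fderiv_flow_self (H : IsFlowBox X h x₀ φ τ) (v : E) :
    fderiv ℝ φ (0, x₀) (0, v) = v := by
  have h1 : HasFDerivAt (fun x ↦ φ (0, x))
      (fderiv ℝ φ (0, x₀) ∘L ContinuousLinearMap.inr ℝ ℝ E) x₀ :=
    HasFDerivAt.comp x₀ H.flow_smooth.hasFDerivAt (hasFDerivAt_prodMk_right _ _)
  have h2 : HasFDerivAt (fun x ↦ φ (0, x)) (ContinuousLinearMap.id ℝ E) x₀ :=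
    (hasFDerivAt_id x₀).congr_of_eventuallyEq H.flow_zero
  exact DFunLike.congr_fun (h1.unique h2) v

theorem fderiv_return_self (H : IsFlowBox X h x₀ φ τ) (v : E) :
    fderiv ℝ (fun x ↦ φ (-τ x, x)) x₀ v = v - fderiv ℝ τ x₀ v • X x₀ := by
  rw [H.fderiv_return.self_of_nhds, H.time_self, neg_zero]
  have : ((-fderiv ℝ τ x₀ v, v) : ℝ × E) =
      (0, v) - fderiv ℝ τ x₀ v • ((1 : ℝ), (0 : E)) := by simp
  rw [this, map_sub, map_smul, H.fderiv_flow_self, H.fderiv_flow_fst.self_of_nhds, H.flow_self]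

/-- Since `h` is constant on return points, its derivative along `X` gives `(1 - dτ(X)) dh(X) = 0`,
and the second factor is nonzero near `x₀`. -/
theorem fderiv_time (H : IsFlowBox X h x₀ φ τ) (hX : SmoothNear X x₀) (hh : SmoothNear h x₀)
    (hne : fderiv ℝ h x₀ (X x₀) ≠ 0) : ∀ᶠ x in 𝓝 x₀, fderiv ℝ τ x (X x) = 1 := by
  have hne' := (hh.fderiv_apply hX).continuousAt.eventually_ne hne
  filter_upwards [H.apply_return.eventually_nhds, H.fderiv_return_field,
    H.tendsto_return.eventually hh, H.tendsto_return.eventually hne', H.return_smooth]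
    with x h1 h2 h3 h4 h5
  have h6 := HasFDerivAt.comp x (h3.differentiableAt (by simp)).hasFDerivAt
    (h5.differentiableAt (by simp)).hasFDerivAt
  have h7 : HasFDerivAt (fun x ↦ h (φ (-τ x, x))) (0 : E →L[ℝ] ℝ) x :=
    (hasFDerivAt_const (h x₀) x).congr_of_eventuallyEq h1
  have h8 := DFunLike.congr_fun (h6.unique h7) (X x)
  rw [ContinuousLinearMap.comp_apply, h2, map_smul, smul_eq_mul, _root_.zero_apply]
    at h8
  linarith [(mul_eq_zero.mp h8).resolve_right h4]

theorem fderiv_time_self (H : IsFlowBox X h x₀ φ τ) (hh : SmoothNear h x₀)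
    (hne : fderiv ℝ h x₀ (X x₀) ≠ 0) :
    fderiv ℝ τ x₀ = (fderiv ℝ h x₀ (X x₀))⁻¹ • fderiv ℝ h x₀ := by
  have hh' : HasFDerivAt h (fderiv ℝ h x₀) (φ (-τ x₀, x₀)) := by
    rw [H.return_self]; exact hh.hasFDerivAt
  have h6 := HasFDerivAt.comp x₀ hh' H.return_smooth.hasFDerivAt
  have h7 : HasFDerivAt (fun x ↦ h (φ (-τ x, x))) (0 : E →L[ℝ] ℝ) x₀ :=
    (hasFDerivAt_const (h x₀) x₀).congr_of_eventuallyEq H.apply_return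
  ext v
  have h8 := DFunLike.congr_fun (h6.unique h7) v
  rw [ContinuousLinearMap.comp_apply, H.fderiv_return_self, map_sub, map_smul, smul_eq_mul,
    _root_.zero_apply] at h8
  rw [_root_.smul_apply, smul_eq_mul, eq_inv_mul_iff_mul_eq₀ hne]
  linarith

end IsFlowBox

variable [FiniteDimensional ℝ E] {X : E → E} {h : E → ℝ} {x₀ : E}

/-- The return time solves `h (φ (-t, x)) = h x₀` for `t`; the derivative in `t` at the base point
is `-dh(X)`. On the hypersurface `t = 0` is a solution, hence the one selected by uniqueness. -/
theorem exists_isFlowBox (hX : SmoothNear X x₀) (hh : SmoothNear h x₀)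
    (hne : fderiv ℝ h x₀ (X x₀) ≠ 0) : ∃ φ τ, IsFlowBox X h x₀ φ τ := by
  have : CompleteSpace E := FiniteDimensional.complete ℝ E
  obtain ⟨φ, hφ, hφ0, h1, h2⟩ := exists_smooth_flow_fderiv hX
  have hφx : φ (0, x₀) = x₀ := hφ0.self_of_nhds
  have hin : SmoothNear (fun z : E × ℝ ↦ φ (-z.2, z.1)) (x₀, 0) := by
    refine SmoothNear.comp (g := φ) ?_ (.of_contDiff (contDiff_snd.neg.prodMk contDiff_fst))
    simpa using hφ
  have hΦ : SmoothNear (fun z : E × ℝ ↦ h (φ (-z.2, z.1))) (x₀, 0) := by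
    refine SmoothNear.comp (g := h) ?_ hin
    simpa [hφx] using hh
  have hder : ∀ v, fderiv ℝ (fun z : E × ℝ ↦ h (φ (-z.2, z.1))) (x₀, 0) (0, v) =
      ContinuousLinearEquiv.unitsEquivAut ℝ (Units.mk0 _ (neg_ne_zero.mpr hne)) v := by
    intro v
    have e0 : HasFDerivAt (fun z : E × ℝ ↦ (-z.2, z.1))
        ((-ContinuousLinearMap.snd ℝ E ℝ).prod (ContinuousLinearMap.fst ℝ E ℝ)) (x₀, 0) :=
      hasFDerivAt_snd.neg.prodMk hasFDerivAt_fst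
    have e1 : HasFDerivAt φ (fderiv ℝ φ (0, x₀)) (-((x₀, (0 : ℝ)) : E × ℝ).2, x₀) := by
      simpa using hφ.hasFDerivAt
    have e2 : HasFDerivAt h (fderiv ℝ h x₀) (φ (-((x₀, (0 : ℝ)) : E × ℝ).2, x₀)) := by
      simpa [hφx] using hh.hasFDerivAt
    have e3 := HasFDerivAt.comp (x₀, (0 : ℝ)) e2 (HasFDerivAt.comp (x₀, (0 : ℝ)) e1 e0)
    have e4 := DFunLike.congr_fun (HasFDerivAt.fderiv e3) (0, v)
    refine e4.trans ?_
    have : ((-v, 0) : ℝ × E) = (-v) • (1, 0) := by simp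
    simp only [ContinuousLinearMap.comp_apply, ContinuousLinearMap.prod_apply,
      _root_.neg_apply, ContinuousLinearMap.coe_snd', ContinuousLinearMap.coe_fst']
    rw [this, map_smul, h1.self_of_nhds, hφx, map_smul]
    simp
  obtain ⟨τ, hτ, hτ0, hret, huniq⟩ := exists_smooth_implicit hΦ _ hder
  refine ⟨φ, τ, hφ, hφ0, h1, h2, hτ, hτ0, ?_, ?_⟩
  · filter_upwards [hret] with x hx
    simpa [hφx] using hx
  · have hc : Tendsto (fun x : E ↦ (x, (0 : ℝ))) (𝓝 x₀) (𝓝 (x₀, 0)) := by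
      exact (Continuous.prodMk_left (0 : ℝ)).tendsto x₀
    filter_upwards [hc.eventually huniq, hφ0] with x hx hx0 hhx
    refine hx ?_
    simp [hx0, hφx, hhx]

/-- A time function for a vector field transverse to a hypersurface. -/
theorem exists_time_function (hX : SmoothNear X x₀) (hh : SmoothNear h x₀)
    (hne : fderiv ℝ h x₀ (X x₀) ≠ 0) :
    ∃ τ : E → ℝ, SmoothNear τ x₀ ∧ (∀ᶠ x in 𝓝 x₀, fderiv ℝ τ x (X x) = 1) ∧
      ∀ᶠ x in 𝓝 x₀, h x = h x₀ → τ x = 0 := by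
  obtain ⟨φ, τ, H⟩ := exists_isFlowBox hX hh hne
  exact ⟨τ, H.time_smooth, H.fderiv_time hX hh hne, H.time_eq_zero⟩

/-- Local solvability of the Cauchy problem `X F = 0`, `F = f` on the hypersurface `h = h x₀`. -/
theorem exists_first_integral (hX : SmoothNear X x₀) (hh : SmoothNear h x₀)
    (hne : fderiv ℝ h x₀ (X x₀) ≠ 0) {f : E → ℝ} (hf : SmoothNear f x₀) :
    ∃ F : E → ℝ, SmoothNear F x₀ ∧ (∀ᶠ x in 𝓝 x₀, fderiv ℝ F x (X x) = 0) ∧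
      (∀ᶠ x in 𝓝 x₀, h x = h x₀ → F x = f x) ∧
      ∃ c : ℝ, fderiv ℝ F x₀ = fderiv ℝ f x₀ + c • fderiv ℝ h x₀ := by
  obtain ⟨φ, τ, H⟩ := exists_isFlowBox hX hh hne
  have hf' : SmoothNear f (φ (-τ x₀, x₀)) := by rwa [H.return_self]
  refine ⟨fun x ↦ f (φ (-τ x, x)), SmoothNear.comp (g := f) hf' H.return_smooth, ?_, ?_, ?_⟩
  · filter_upwards [H.fderiv_return_field, H.fderiv_time hX hh hne, H.return_smooth,
      H.tendsto_return.eventually hf] with x h1 h2 h3 h4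
    rw [fderiv_comp_eq (g := f) (f := fun x ↦ φ (-τ x, x)) (h4.differentiableAt (by simp))
      (h3.differentiableAt (by simp)), h1, h2]
    simp
  · filter_upwards [H.time_eq_zero, H.flow_zero] with x h1 h2 h3
    rw [h1 h3, neg_zero, h2]
  -- At `x₀` the return map has derivative `v ↦ v - dτ(v) X`, with `dτ = dh / dh(X)`.
  · refine ⟨-(fderiv ℝ f x₀ (X x₀) * (fderiv ℝ h x₀ (X x₀))⁻¹), ?_⟩
    ext v
    rw [fderiv_comp_eq (g := f) (f := fun x ↦ φ (-τ x, x)) hf'.differentiableAt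
      H.return_smooth.differentiableAt, H.fderiv_return_self, H.return_self,
      H.fderiv_time_self hh hne]
    simp only [_root_.smul_apply, smul_eq_mul, map_sub, map_smul,
      _root_.add_apply]
    ring

/-- Uniqueness for the Cauchy problem. -/
theorem first_integral_unique (hX : SmoothNear X x₀) (hh : SmoothNear h x₀)
    (hne : fderiv ℝ h x₀ (X x₀) ≠ 0) {F : E → ℝ} (hF : SmoothNear F x₀)
    (hXF : ∀ᶠ x in 𝓝 x₀, fderiv ℝ F x (X x) = 0) (hF0 : ∀ᶠ x in 𝓝 x₀, h x = h x₀ → F x = 0) :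
    ∀ᶠ x in 𝓝 x₀, F x = 0 := by
  obtain ⟨φ, τ, H⟩ := exists_isFlowBox hX hh hne
  have hconst : ∀ᶠ p in 𝓝 ((0 : ℝ), x₀), HasDerivAt (fun t ↦ F (φ (t, p.2))) 0 p.1 := by
    filter_upwards [H.flow_smooth, H.fderiv_flow_fst, H.tendsto_flow.eventually hF,
      H.tendsto_flow.eventually hXF] with p h1 h2 h3 h4
    have e1 : HasDerivAt (fun t : ℝ ↦ (t, p.2)) (1, 0) p.1 :=
      (hasDerivAt_id p.1).prodMk (hasDerivAt_const p.1 p.2)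
    have e2 := (h1.differentiableAt (by simp)).hasFDerivAt.comp_hasDerivAt p.1 e1
    have e3 := (h3.differentiableAt (by simp)).hasFDerivAt.comp_hasDerivAt p.1 e2
    rw [h2, h4] at e3
    exact e3
  obtain ⟨ε, hε, hball⟩ := Metric.eventually_nhds_iff.mp hconst
  filter_upwards [H.flow_zero, H.tendsto_returnArg.eventually (Metric.ball_mem_nhds _ hε),
    H.tendsto_return.eventually hF0, H.apply_return] with x h1 h2 h3 h4
  rw [Prod.dist_eq, max_lt_iff, Real.dist_eq, sub_zero, abs_lt] at h2
  -- `F` is constant on the orbit from `x` back to the hypersurface, where it vanishes.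
  have hd : ∀ t ∈ Ioo (-ε) ε, HasDerivAt (fun t ↦ F (φ (t, x))) 0 t := fun t ht ↦
    @hball (t, x) (by
      rw [Prod.dist_eq, max_lt_iff, Real.dist_eq, sub_zero, abs_lt]
      exact ⟨ht, h2.2⟩)
  have h5 := isOpen_Ioo.is_const_of_deriv_eq_zero isPreconnected_Ioo
    (fun t ht ↦ (hd t ht).differentiableAt.differentiableWithinAt)
    (fun t ht ↦ (hd t ht).deriv) (x := -τ x) (y := 0) h2.1 ⟨by linarith, hε⟩
  simp only [h1] at h5
  rw [← h5, h3 h4]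

/-- Uniqueness for the Cauchy problem along a linear subspace to which the vector field is
tangent. -/
theorem first_integral_unique_on (V : Submodule ℝ E) (hx₀ : x₀ ∈ V) (hX : SmoothNear X x₀)
    (hXV : ∀ᶠ x in 𝓝 x₀, x ∈ V → X x ∈ V) (hh : SmoothNear h x₀)
    (hne : fderiv ℝ h x₀ (X x₀) ≠ 0) {F : E → ℝ} (hF : SmoothNear F x₀)
    (hXF : ∀ᶠ x in 𝓝 x₀, x ∈ V → fderiv ℝ F x (X x) = 0)
    (hF0 : ∀ᶠ x in 𝓝 x₀, x ∈ V → h x = h x₀ → F x = 0) :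
    ∀ᶠ x in 𝓝 x₀, x ∈ V → F x = 0 := by
  -- A linear retraction onto `V` turns `X` into a vector field on the vector space `V`, to which
  -- the previous uniqueness theorem applies.
  obtain ⟨P, hP⟩ := V.subtype.exists_leftInverse_of_injective V.ker_subtype
  have hPV : ∀ v ∈ V, (P v : E) = v := fun v hv ↦
    congrArg Subtype.val (DFunLike.congr_fun hP ⟨v, hv⟩)
  let y₀ : V := ⟨x₀, hx₀⟩
  let ι : V →L[ℝ] E := V.subtypeL
  have hι : Tendsto ι (𝓝 y₀) (𝓝 x₀) := ι.continuous.tendsto y₀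
  let Y : V → V := fun y ↦ P.toContinuousLinearMap (X (ι y))
  have hXι : SmoothNear (fun y ↦ X (ι y)) y₀ := SmoothNear.comp (g := X) (f := ι) hX (.clm ι)
  have hY : SmoothNear Y y₀ := (SmoothNear.clm (P.toContinuousLinearMap)).comp hXι
  have hYX : ∀ᶠ y in 𝓝 y₀, ι (Y y) = X (ι y) := by
    filter_upwards [hι.eventually hXV] with y hy using hPV _ (hy y.2)
  have hderiv : ∀ {g : E → ℝ} {y : V}, DifferentiableAt ℝ g (ι y) → ∀ w,
      fderiv ℝ (fun z ↦ g (ι z)) y w = fderiv ℝ g (ι y) (ι w) := fun hg w ↦ by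
    rw [fderiv_comp_eq hg ι.differentiableAt, ι.fderiv]
  have key := first_integral_unique (X := Y) (h := fun y ↦ h (ι y)) (F := fun y ↦ F (ι y))
    (x₀ := y₀) hY (SmoothNear.comp (g := h) (f := ι) hh (.clm ι)) ?_
    (SmoothNear.comp (g := F) (f := ι) hF (.clm ι)) ?_ ?_
  · rw [nhds_subtype, eventually_comap] at key
    filter_upwards [key] with x hx hxV using hx ⟨x, hxV⟩ rfl
  · rw [hderiv hh.differentiableAt, hYX.self_of_nhds]
    exact hne
  · filter_upwards [hYX, hι.eventually hF, hι.eventually hXF] with y h1 h2 h3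
    rw [hderiv (h2.differentiableAt (by simp)), h1, h3 y.2]
  · filter_upwards [hι.eventually hF0] with y hy using hy y.2

/-- A function that vanishes on a level set of `h` has vanishing derivative on this level set along
the vector fields that annihilate `h`. -/
theorem fderiv_eq_zero_of_tangent {Y : E → E} (hY : SmoothNear Y x₀) (hh : SmoothNear h x₀)
    (hYh : ∀ᶠ x in 𝓝 x₀, fderiv ℝ h x (Y x) = 0) {F : E → ℝ} (hF : SmoothNear F x₀) {a : ℝ}
    (hF0 : ∀ᶠ x in 𝓝 x₀, h x = a → F x = 0) :
    ∀ᶠ x in 𝓝 x₀, h x = a → fderiv ℝ F x (Y x) = 0 := by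
  obtain ⟨φ, hφ, hφ0, h1, -⟩ := exists_smooth_flow_fderiv hY
  have hlim : Tendsto φ (𝓝 ((0 : ℝ), x₀)) (𝓝 x₀) := by
    simpa only [hφ0.self_of_nhds] using hφ.continuousAt.tendsto
  have hder : ∀ {g : E → ℝ}, SmoothNear g x₀ → ∀ᶠ p in 𝓝 ((0 : ℝ), x₀),
      HasDerivAt (fun t ↦ g (φ (t, p.2))) (fderiv ℝ g (φ p) (Y (φ p))) p.1 := by
    intro g hg
    filter_upwards [hφ, h1, hlim.eventually hg] with p h1 h2 h3
    have e1 : HasDerivAt (fun t : ℝ ↦ (t, p.2)) (1, 0) p.1 :=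
      (hasDerivAt_id p.1).prodMk (hasDerivAt_const p.1 p.2)
    have e2 := (h1.differentiableAt (by simp)).hasFDerivAt.comp_hasDerivAt p.1 e1
    have e3 := (h3.differentiableAt (by simp)).hasFDerivAt.comp_hasDerivAt p.1 e2
    rw [h2] at e3
    exact e3
  obtain ⟨ε, hε, hball⟩ := Metric.eventually_nhds_iff.mp
    (((hder hh).and (hlim.eventually hYh)).and ((hder hF).and (hlim.eventually hF0)))
  filter_upwards [hφ0, Metric.ball_mem_nhds _ hε] with x h2 h3 h4
  have hb : ∀ t ∈ Ioo (-ε) ε, dist ((t, x) : ℝ × E) (0, x₀) < ε := fun t ht ↦ by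
    rw [Prod.dist_eq, max_lt_iff, Real.dist_eq, sub_zero, abs_lt]
    exact ⟨ht, h3⟩
  have h0 : (0 : ℝ) ∈ Ioo (-ε) ε := ⟨by linarith, hε⟩
  have hd : ∀ t ∈ Ioo (-ε) ε, HasDerivAt (fun t ↦ h (φ (t, x))) 0 t := fun t ht ↦ by
    have := (hball (hb t ht)).1
    rw [this.2] at this
    exact this.1
  -- The flow of `Y` stays in the level set, so `F` vanishes along the orbit and so does its
  -- derivative.
  have hconst : ∀ t ∈ Ioo (-ε) ε, h (φ (t, x)) = a := fun t ht ↦ by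
    rw [isOpen_Ioo.is_const_of_deriv_eq_zero isPreconnected_Ioo
      (fun t ht ↦ (hd t ht).differentiableAt.differentiableWithinAt)
      (fun t ht ↦ (hd t ht).deriv) ht h0, h2, h4]
  have hF1 : (fun t ↦ F (φ (t, x))) =ᶠ[𝓝 0] fun _ ↦ 0 := by
    filter_upwards [Ioo_mem_nhds h0.1 h0.2] with t ht
    exact (hball (hb t ht)).2.2 (hconst t ht)
  have := (hball (hb 0 h0)).2.1.unique ((hasDerivAt_const (0 : ℝ) (0 : ℝ)).congr_of_eventuallyEq hF1)
  rwa [h2] at this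

end Cauchy

/-! ### Poisson brackets near a point of a normed space. -/

section LocalPoisson

variable {E : Type*} [NormedAddCommGroup E] [NormedSpace ℝ E]

/-- The bracket of two functions on a normed space defined by a family of bilinear forms on
covectors. -/
def localBracket (B : E → (E →L[ℝ] ℝ) →L[ℝ] (E →L[ℝ] ℝ) →L[ℝ] ℝ) (f g : E → ℝ) (x : E) : ℝ :=
  B x (fderiv ℝ f x) (fderiv ℝ g x)

/-- `B` is a smooth Poisson bivector near `x₀`. -/
structure IsPoissonNear (B : E → (E →L[ℝ] ℝ) →L[ℝ] (E →L[ℝ] ℝ) →L[ℝ] ℝ) (x₀ : E) : Prop where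
  smooth : SmoothNear B x₀
  skew : ∀ᶠ x in 𝓝 x₀, ∀ α β, B x α β = - B x β α
  jacobi : ∀ᶠ x in 𝓝 x₀, ∀ f g h : E → ℝ, SmoothNear f x → SmoothNear g x → SmoothNear h x →
    localBracket B f (localBracket B g h) x + localBracket B g (localBracket B h f) x +
      localBracket B h (localBracket B f g) x = 0

variable {B : E → (E →L[ℝ] ℝ) →L[ℝ] (E →L[ℝ] ℝ) →L[ℝ] ℝ} {x₀ : E} {f g h : E → ℝ}

theorem localBracket_congr_right {g' : E → ℝ} {x : E} (hg : g =ᶠ[𝓝 x] g') :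
    localBracket B f g x = localBracket B f g' x := by
  rw [localBracket, hg.fderiv_eq, localBracket]

theorem localBracket_eq_zero_of_eventually_const {x : E} {c : ℝ} (hg : ∀ᶠ y in 𝓝 x, g y = c) :
    localBracket B f g x = 0 := by
  rw [localBracket_congr_right (g' := fun _ ↦ c) hg]
  simp [localBracket]

/-- The Hamiltonian vector field of a function. -/
def hamiltonianField [FiniteDimensional ℝ E]
    (B : E → (E →L[ℝ] ℝ) →L[ℝ] (E →L[ℝ] ℝ) →L[ℝ] ℝ) (f : E → ℝ) (x : E) : E :=
  ∑ i, B x (fderiv ℝ f x) (LinearMap.toContinuousLinearMap ((Module.finBasis ℝ E).coord i)) •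
    Module.finBasis ℝ E i

theorem apply_hamiltonianField [FiniteDimensional ℝ E] (f : E → ℝ) (x : E) (α : E →L[ℝ] ℝ) :
    α (hamiltonianField B f x) = B x (fderiv ℝ f x) α := by
  have h : α = ∑ i, α (Module.finBasis ℝ E i) •
      LinearMap.toContinuousLinearMap ((Module.finBasis ℝ E).coord i) := by
    ext v
    conv_lhs => rw [← (Module.finBasis ℝ E).sum_repr v, map_sum]
    simp [mul_comm]
  conv_rhs => rw [h]
  simp [hamiltonianField, mul_comm]

theorem fderiv_hamiltonianField [FiniteDimensional ℝ E] (f g : E → ℝ) (x : E) :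
    fderiv ℝ g x (hamiltonianField B f x) = localBracket B f g x :=
  apply_hamiltonianField f x _

namespace IsPoissonNear

theorem bracket_smooth (hB : IsPoissonNear B x₀) (hf : SmoothNear f x₀) (hg : SmoothNear g x₀) :
    SmoothNear (localBracket B f g) x₀ :=
  (hB.smooth.clm_apply hf.fderiv).clm_apply hg.fderiv

theorem hamiltonianField_smooth [FiniteDimensional ℝ E] (hB : IsPoissonNear B x₀)
    (hf : SmoothNear f x₀) : SmoothNear (hamiltonianField B f) x₀ :=
  SmoothNear.sum fun _ _ ↦
    ((hB.smooth.clm_apply hf.fderiv).clm_apply (.const _)).smul (.const _)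

theorem bracket_skew (hB : IsPoissonNear B x₀) (f g : E → ℝ) :
    ∀ᶠ x in 𝓝 x₀, localBracket B f g x = - localBracket B g f x := by
  filter_upwards [hB.skew] with x hx using hx _ _

theorem bracket_self (hB : IsPoissonNear B x₀) (f : E → ℝ) :
    ∀ᶠ x in 𝓝 x₀, localBracket B f f x = 0 := by
  filter_upwards [hB.bracket_skew f f] with x hx
  linarith

/-- Hamiltonian vector fields of functions with constant bracket commute. -/
theorem bracket_comm (hB : IsPoissonNear B x₀) (hf : SmoothNear f x₀) (hg : SmoothNear g x₀)
    (hh : SmoothNear h x₀) {c : ℝ} (hfg : ∀ᶠ x in 𝓝 x₀, localBracket B f g x = c) :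
    ∀ᶠ x in 𝓝 x₀, localBracket B f (localBracket B g h) x =
      localBracket B g (localBracket B f h) x := by
  filter_upwards [hB.jacobi, hf.eventually, hg.eventually, hh.eventually, hfg.eventually_nhds,
    (hB.bracket_skew h f).eventually_nhds] with x h1 h2 h3 h4 h5 h6
  have h7 := h1 f g h h2 h3 h4
  rw [localBracket_eq_zero_of_eventually_const h5, localBracket_congr_right (f := g) h6] at h7
  have h8 : localBracket B g (fun y ↦ -localBracket B f h y) x =
      - localBracket B g (localBracket B f h) x := by
    rw [localBracket, fderiv_fun_neg, map_neg, localBracket]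
  rw [h8] at h7
  linarith

/-- If `{G, F}` is constant and `F` agrees with `f` on the hypersurface `h = h x₀`, then `F`
commutes with all functions `K` that commute with `h` and `f` and have constant bracket with `G`. -/
theorem bracket_eq_zero_of_initial [FiniteDimensional ℝ E] (hB : IsPoissonNear B x₀)
    {G F K : E → ℝ} (hG : SmoothNear G x₀) (hh : SmoothNear h x₀) (hF : SmoothNear F x₀)
    (hf : SmoothNear f x₀) (hK : SmoothNear K x₀) (hne : localBracket B G h x₀ ≠ 0) {c d : ℝ}
    (hGF : ∀ᶠ x in 𝓝 x₀, localBracket B G F x = c) (hFf : ∀ᶠ x in 𝓝 x₀, h x = h x₀ → F x = f x)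
    (hKG : ∀ᶠ x in 𝓝 x₀, localBracket B K G x = d) (hKh : ∀ᶠ x in 𝓝 x₀, localBracket B K h x = 0)
    (hKf : ∀ᶠ x in 𝓝 x₀, localBracket B K f x = 0) :
    ∀ᶠ x in 𝓝 x₀, localBracket B K F x = 0 := by
  -- The bracket `{K, F}` is a first integral of the Hamiltonian field of `G`. Its initial values
  -- vanish because the Hamiltonian field of `K` is tangent to the hypersurface, where `F - f = 0`,
  -- and `{K, f} = 0`.
  refine first_integral_unique (hB.hamiltonianField_smooth hG) hh ?_ (hB.bracket_smooth hK hF)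
    ?_ ?_
  · rwa [fderiv_hamiltonianField]
  · filter_upwards [hB.bracket_comm hK hG hF hKG, hGF.eventually_nhds] with x h1 h2
    rw [fderiv_hamiltonianField, ← h1, localBracket_eq_zero_of_eventually_const h2]
  · have := fderiv_eq_zero_of_tangent (hB.hamiltonianField_smooth hK) hh (a := h x₀)
      (F := fun x ↦ F x - f x)
      (by simpa only [fderiv_hamiltonianField] using hKh) (hF.sub hf)
      (by filter_upwards [hFf] with x h1 h2 using sub_eq_zero.mpr (h1 h2))
    filter_upwards [this, hF, hf, hKf] with x h1 h2 h3 h4 h5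
    have h6 := h1 h5
    rw [fderiv_hamiltonianField, localBracket, fderiv_fun_sub (h2.differentiableAt (by simp))
      (h3.differentiableAt (by simp)), map_sub] at h6
    change localBracket B K F x - localBracket B K f x = 0 at h6
    rwa [h4, sub_zero] at h6

theorem exists_commuting [FiniteDimensional ℝ E] (hB : IsPoissonNear B x₀)
    {G H : E → ℝ} (hG : SmoothNear G x₀) (hH : SmoothNear H x₀) (hf : SmoothNear f x₀)
    (hne : localBracket B G H x₀ ≠ 0) :
    ∃ F : E → ℝ, SmoothNear F x₀ ∧ (∀ᶠ x in 𝓝 x₀, localBracket B G F x = 0) ∧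
      (∀ᶠ x in 𝓝 x₀, H x = H x₀ → F x = f x) ∧
      (∃ c : ℝ, fderiv ℝ F x₀ = fderiv ℝ f x₀ + c • fderiv ℝ H x₀) ∧
      ∀ K : E → ℝ, SmoothNear K x₀ → (∃ d, ∀ᶠ x in 𝓝 x₀, localBracket B K G x = d) →
        (∀ᶠ x in 𝓝 x₀, localBracket B K H x = 0) → (∀ᶠ x in 𝓝 x₀, localBracket B K f x = 0) →
        ∀ᶠ x in 𝓝 x₀, localBracket B K F x = 0 := by
  obtain ⟨F, hF, h1, h2, h3⟩ := exists_first_integral (hB.hamiltonianField_smooth hG) hH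
    (by rwa [fderiv_hamiltonianField]) hf
  simp only [fderiv_hamiltonianField] at h1
  exact ⟨F, hF, h1, h2, h3, fun K hK ⟨d, hd⟩ hKH hKf ↦
    hB.bracket_eq_zero_of_initial hG hH hF hf hK hne h1 h2 hd hKH hKf⟩

end IsPoissonNear

/-- Near `x₀` the linear subspace `V` is coisotropic with respect to `B`. -/
def IsCoisotropicNear (B : E → (E →L[ℝ] ℝ) →L[ℝ] (E →L[ℝ] ℝ) →L[ℝ] ℝ) (V : Submodule ℝ E)
    (x₀ : E) : Prop :=
  ∀ᶠ x in 𝓝 x₀, x ∈ V → ∀ α β : E →L[ℝ] ℝ, (∀ v ∈ V, α v = 0) → (∀ v ∈ V, β v = 0) → B x α β = 0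

variable {V : Submodule ℝ E}

theorem fderiv_eq_zero_of_vanishing (hf : SmoothNear f x₀) (hfV : ∀ᶠ x in 𝓝 x₀, x ∈ V → f x = 0) :
    ∀ᶠ x in 𝓝 x₀, x ∈ V → ∀ v ∈ V, fderiv ℝ f x v = 0 := by
  filter_upwards [hf, hfV.eventually_nhds] with x h1 h2 hx v hv
  have h3 : HasDerivAt (fun t : ℝ ↦ x + t • v) v 0 := by
    simpa using ((hasDerivAt_id (0 : ℝ)).smul_const v).const_add x
  have h4 : HasFDerivAt f (fderiv ℝ f x) (x + (0 : ℝ) • v) := by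
    simpa using (h1.differentiableAt (by simp)).hasFDerivAt
  have h5 := h4.comp_hasDerivAt (0 : ℝ) h3
  have h6 : Tendsto (fun t : ℝ ↦ x + t • v) (𝓝 0) (𝓝 x) := by
    simpa using h3.continuousAt.tendsto
  refine h5.unique ((hasDerivAt_const (0 : ℝ) (0 : ℝ)).congr_of_eventuallyEq ?_)
  filter_upwards [h6.eventually h2] with t ht
  exact ht (V.add_mem hx (V.smul_mem t hv))

theorem mem_of_forall_annihilator [FiniteDimensional ℝ E] {w : E}
    (h : ∀ α : E →L[ℝ] ℝ, (∀ v ∈ V, α v = 0) → α w = 0) : w ∈ V := by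
  by_contra hw
  obtain ⟨α, hα, hV⟩ := Submodule.exists_le_ker_of_notMem hw
  exact hα (h (LinearMap.toContinuousLinearMap α) fun v hv ↦ hV hv)

/-- On `V` the differential of `f` is conormal, so coisotropy pairs it to zero with every conormal
covector; a vector killed by all of these lies in `V`. -/
theorem IsCoisotropicNear.hamiltonianField_mem [FiniteDimensional ℝ E]
    (hV : IsCoisotropicNear B V x₀) (hf : SmoothNear f x₀)
    (hfV : ∀ᶠ x in 𝓝 x₀, x ∈ V → f x = 0) :
    ∀ᶠ x in 𝓝 x₀, x ∈ V → hamiltonianField B f x ∈ V := by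
  filter_upwards [hV, fderiv_eq_zero_of_vanishing hf hfV] with x h1 h2 hx
  refine mem_of_forall_annihilator fun α hα ↦ ?_
  rw [apply_hamiltonianField]
  exact h1 hx _ _ (h2 hx) hα

/-! ### Inductive construction of canonical pairs adapted to `V`. -/

/-- A system of `j` canonical pairs of functions near `x₀`, the second of which vanish on `V`. -/
structure IsCanonicalSystem (B : E → (E →L[ℝ] ℝ) →L[ℝ] (E →L[ℝ] ℝ) →L[ℝ] ℝ) (V : Submodule ℝ E)
    (x₀ : E) (j : ℕ) (q p : ℕ → E → ℝ) : Prop where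
  smooth_q : ∀ a < j, SmoothNear (q a) x₀
  smooth_p : ∀ a < j, SmoothNear (p a) x₀
  bracket_qq : ∀ a < j, ∀ b < j, ∀ᶠ x in 𝓝 x₀, localBracket B (q a) (q b) x = 0
  bracket_pp : ∀ a < j, ∀ b < j, ∀ᶠ x in 𝓝 x₀, localBracket B (p a) (p b) x = 0
  bracket_qp : ∀ a < j, ∀ b < j, ∀ᶠ x in 𝓝 x₀,
    localBracket B (q a) (p b) x = if a = b then 1 else 0
  vanish_p : ∀ a < j, ∀ᶠ x in 𝓝 x₀, x ∈ V → p a x = 0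

/-- The span of the differentials at `x₀` of the functions `u 0, …, u (j - 1)`. -/
def differentialSpan (x₀ : E) (j : ℕ) (u : ℕ → E → ℝ) : Submodule ℝ (E →L[ℝ] ℝ) :=
  Submodule.span ℝ (range fun a : Fin j ↦ fderiv ℝ (u a) x₀)

theorem fderiv_mem_differentialSpan {j : ℕ} (u : ℕ → E → ℝ) {a : ℕ} (ha : a < j) :
    fderiv ℝ (u a) x₀ ∈ differentialSpan x₀ j u :=
  Submodule.subset_span ⟨⟨a, ha⟩, rfl⟩

namespace IsCanonicalSystem

variable {j : ℕ} {q p : ℕ → E → ℝ}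

theorem bracket_pq (H : IsCanonicalSystem B V x₀ j q p) (hB : IsPoissonNear B x₀) {a b : ℕ}
    (ha : a < j) (hb : b < j) :
    ∀ᶠ x in 𝓝 x₀, localBracket B (p a) (q b) x = if a = b then -1 else 0 := by
  filter_upwards [H.bracket_qp b hb a ha, hB.bracket_skew (p a) (q b)] with x h1 h2
  rw [h2, h1]
  by_cases hab : a = b
  · simp [hab]
  · simp [hab, Ne.symm hab]

variable [FiniteDimensional ℝ E]

/-- Functions can be modified so as to commute with the members of a canonical system. -/
theorem exists_commuting_aux (H : IsCanonicalSystem B V x₀ j q p) (hB : IsPoissonNear B x₀)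
    (hV : IsCoisotropicNear B V x₀) (hx₀ : x₀ ∈ V) (hf : SmoothNear f x₀) (r : ℕ) (hr : r ≤ j) :
    ∃ F : E → ℝ, SmoothNear F x₀ ∧ (∀ a < r, ∀ᶠ x in 𝓝 x₀, localBracket B (q a) F x = 0) ∧
      (∀ a < r, ∀ᶠ x in 𝓝 x₀, localBracket B (p a) F x = 0) ∧
      fderiv ℝ F x₀ - fderiv ℝ f x₀ ∈ differentialSpan x₀ j q ⊔ differentialSpan x₀ j p ∧
      ((∀ᶠ x in 𝓝 x₀, x ∈ V → f x = 0) → (∀ᶠ x in 𝓝 x₀, x ∈ V → F x = 0) ∧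
        fderiv ℝ F x₀ - fderiv ℝ f x₀ ∈ differentialSpan x₀ j p) := by
  induction r with
  | zero => exact ⟨f, hf, by simp, by simp, by simp, fun h ↦ ⟨h, by simp⟩⟩
  | succ r ih =>
    obtain ⟨F, hF, hqF, hpF, hdF, hVF⟩ := ih (by omega)
    have hrj : r < j := hr
    have hpq0 : localBracket B (p r) (q r) x₀ = -1 := by
      simpa using (H.bracket_pq hB hrj hrj).self_of_nhds
    have hqp0 : localBracket B (q r) (p r) x₀ = 1 := by
      simpa using (H.bracket_qp r hrj r hrj).self_of_nhds
    -- Two corrections per pair: along the field of `p r` with data on a level of `q r`, then along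
    -- the field of `q r` with data on `p r = 0`. The second preserves the relation `{p r, F'} = 0`,
    -- and its data hypersurface contains `V` near `x₀`.
    obtain ⟨F', hF', hpF', hFF', ⟨c', hc'⟩, hK'⟩ := hB.exists_commuting (H.smooth_p r hrj)
      (H.smooth_q r hrj) hF (by rw [hpq0]; norm_num)
    obtain ⟨F'', hF'', hqF'', hFF'', ⟨c'', hc''⟩, hK''⟩ := hB.exists_commuting (H.smooth_q r hrj)
      (H.smooth_p r hrj) hF' (by rw [hqp0]; norm_num)
    refine ⟨F'', hF'', fun a ha ↦ ?_, fun a ha ↦ ?_, ?_, fun hfV ↦ ?_⟩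
    · rcases Nat.lt_succ_iff_lt_or_eq.mp ha with har | rfl
      · have haj : a < j := by omega
        have hqp : ∀ᶠ x in 𝓝 x₀, localBracket B (q a) (p r) x = 0 := by
          simpa [har.ne] using H.bracket_qp a haj r hrj
        exact hK'' _ (H.smooth_q a haj) ⟨0, H.bracket_qq a haj r hrj⟩ hqp
          (hK' _ (H.smooth_q a haj) ⟨0, hqp⟩ (H.bracket_qq a haj r hrj) (hqF a har))
      · exact hqF''
    · have haj : a < j := by omega
      refine hK'' _ (H.smooth_p a haj) ⟨_, H.bracket_pq hB haj hrj⟩ (H.bracket_pp a haj r hrj) ?_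
      rcases Nat.lt_succ_iff_lt_or_eq.mp ha with har | rfl
      · exact hK' _ (H.smooth_p a haj) ⟨0, H.bracket_pp a haj r hrj⟩
          (by simpa [har.ne] using H.bracket_pq hB haj hrj) (hpF a har)
      · exact hpF'
    · have : fderiv ℝ F'' x₀ - fderiv ℝ f x₀ = (fderiv ℝ F x₀ - fderiv ℝ f x₀) +
          (c' • fderiv ℝ (q r) x₀ + c'' • fderiv ℝ (p r) x₀) := by
        rw [hc'', hc']; abel
      rw [this]
      exact add_mem hdF (Submodule.add_mem_sup
        (Submodule.smul_mem _ _ (fderiv_mem_differentialSpan q hrj))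
        (Submodule.smul_mem _ _ (fderiv_mem_differentialSpan p hrj)))
    · obtain ⟨hFV, hdF⟩ := hVF hfV
      have hF'V : ∀ᶠ x in 𝓝 x₀, x ∈ V → F' x = 0 := by
        -- The level set of `q r` does not contain `V`, so vanishing of `F'` on `V` needs uniqueness
        -- inside `V`, to which the field of `p r` is tangent.
        refine first_integral_unique_on V hx₀ (hB.hamiltonianField_smooth (H.smooth_p r hrj))
          (hV.hamiltonianField_mem (H.smooth_p r hrj) (H.vanish_p r hrj)) (H.smooth_q r hrj)
          ?_ hF' ?_ ?_
        · rw [fderiv_hamiltonianField, hpq0]; norm_num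
        · filter_upwards [hpF'] with x hx _
          rw [fderiv_hamiltonianField, hx]
        · filter_upwards [hFF', hFV] with x h1 h2 h3 h4
          rw [h1 h4, h2 h3]
      have hF''V : ∀ᶠ x in 𝓝 x₀, x ∈ V → F'' x = 0 := by
        have hp0 := (H.vanish_p r hrj).self_of_nhds hx₀
        filter_upwards [hFF'', hF'V, H.vanish_p r hrj] with x h1 h2 h3 h4
        rw [h1 (by rw [hp0, h3 h4]), h2 h4]
      refine ⟨hF''V, ?_⟩
      -- By coisotropy `dp r` pairs to zero with `dF` and `dF'`, hence with their difference `c' dq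
      -- r`. As `{p r, q r} = -1`, this forces `c' = 0`: only `dp`-terms are added.
      have e1 := fun {g : E → ℝ} (hg : SmoothNear g x₀) (hgV : ∀ᶠ x in 𝓝 x₀, x ∈ V → g x = 0) ↦
        hV.self_of_nhds hx₀ (fderiv ℝ (p r) x₀) (fderiv ℝ g x₀)
        ((fderiv_eq_zero_of_vanishing (H.smooth_p r hrj) (H.vanish_p r hrj)).self_of_nhds hx₀)
        ((fderiv_eq_zero_of_vanishing hg hgV).self_of_nhds hx₀)
      have e2 := e1 hF' hF'V
      rw [hc', map_add, e1 hF hFV, map_smul, zero_add] at e2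
      change c' • localBracket B (p r) (q r) x₀ = 0 at e2
      have hc0 : c' = 0 := by simpa [hpq0] using e2
      have : fderiv ℝ F'' x₀ - fderiv ℝ f x₀ = (fderiv ℝ F x₀ - fderiv ℝ f x₀) +
          c'' • fderiv ℝ (p r) x₀ := by
        rw [hc'', hc', hc0]; simp; abel
      rw [this]
      exact add_mem hdF (Submodule.smul_mem _ _ (fderiv_mem_differentialSpan p hrj))

theorem exists_commuting (H : IsCanonicalSystem B V x₀ j q p) (hB : IsPoissonNear B x₀)
    (hV : IsCoisotropicNear B V x₀) (hx₀ : x₀ ∈ V) (hf : SmoothNear f x₀) :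
    ∃ F : E → ℝ, SmoothNear F x₀ ∧ (∀ a < j, ∀ᶠ x in 𝓝 x₀, localBracket B (q a) F x = 0) ∧
      (∀ a < j, ∀ᶠ x in 𝓝 x₀, localBracket B (p a) F x = 0) ∧
      fderiv ℝ F x₀ - fderiv ℝ f x₀ ∈ differentialSpan x₀ j q ⊔ differentialSpan x₀ j p ∧
      ((∀ᶠ x in 𝓝 x₀, x ∈ V → f x = 0) → (∀ᶠ x in 𝓝 x₀, x ∈ V → F x = 0) ∧
        fderiv ℝ F x₀ - fderiv ℝ f x₀ ∈ differentialSpan x₀ j p) :=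
  H.exists_commuting_aux hB hV hx₀ hf j le_rfl

/-- A canonical system with fewer pairs than the codimension of `V` can be extended. -/
theorem exists_extend (H : IsCanonicalSystem B V x₀ j q p) (hB : IsPoissonNear B x₀)
    (hV : IsCoisotropicNear B V x₀) (hx₀ : x₀ ∈ V)
    (hrank : ∀ α : E →L[ℝ] ℝ, (∀ v ∈ V, α v = 0) → (∀ β, B x₀ α β = 0) → α = 0)
    (hj : Module.finrank ℝ V + j < Module.finrank ℝ E) :
    ∃ q' p', IsCanonicalSystem B V x₀ (j + 1) q' p' := by
  -- The annihilator of `V` has dimension greater than `j`, while the `dp` span at most `j`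
  -- dimensions.
  obtain ⟨α, hαV, hα⟩ : ∃ α : E →L[ℝ] ℝ, (∀ v ∈ V, α v = 0) ∧ α ∉ differentialSpan x₀ j p := by
    by_contra! hcon
    have h1 : V.dualAnnihilator.map (LinearMap.toContinuousLinearMap :
        (E →ₗ[ℝ] ℝ) ≃ₗ[ℝ] (E →L[ℝ] ℝ)).toLinearMap ≤ differentialSpan x₀ j p := by
      rintro _ ⟨φ, hφ, rfl⟩
      exact hcon _ fun v hv ↦ (Submodule.mem_dualAnnihilator φ).mp hφ v hv
    have h2 := (LinearEquiv.finrank_map_eq (LinearMap.toContinuousLinearMap :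
      (E →ₗ[ℝ] ℝ) ≃ₗ[ℝ] (E →L[ℝ] ℝ)) V.dualAnnihilator).symm.trans_le (Submodule.finrank_mono h1)
    have h3 := Subspace.finrank_add_finrank_dualAnnihilator_eq V
    have h4 : Module.finrank ℝ (differentialSpan x₀ j p) ≤ j :=
      (finrank_range_le_card (R := ℝ) (fun a : Fin j ↦ fderiv ℝ (p a) x₀)).trans (by simp)
    exact (h3.symm.le.trans (Nat.add_le_add_left (h2.trans h4) _)).not_gt hj
  obtain ⟨P, hP, hqP, hpP, -, hPα⟩ := H.exists_commuting hB hV hx₀ (SmoothNear.clm α)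
  obtain ⟨hPV, hdP⟩ := hPα (Eventually.of_forall fun x hx ↦ hαV x hx)
  rw [α.fderiv] at hdP
  -- Otherwise the rank hypothesis gives `dP = 0`; since `dP - α` lies in the span of the `dp`
  -- alone, so would `α`.
  obtain ⟨β, hβ⟩ : ∃ β, B x₀ (fderiv ℝ P x₀) β ≠ 0 := by
    by_contra! hcon
    have := hrank _ ((fderiv_eq_zero_of_vanishing hP hPV).self_of_nhds hx₀) hcon
    rw [this, zero_sub] at hdP
    exact hα (neg_mem_iff.mp hdP)
  obtain ⟨h, hh, hqh, hph, hdh, -⟩ := H.exists_commuting hB hV hx₀ (SmoothNear.clm β)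
  rw [β.fderiv] at hdh
  have hPq : ∀ a < j, ∀ᶠ x in 𝓝 x₀, localBracket B P (q a) x = 0 := fun a ha ↦ by
    filter_upwards [hqP a ha, hB.bracket_skew P (q a)] with x h1 h2
    rw [h2, h1, neg_zero]
  have hPp : ∀ a < j, ∀ᶠ x in 𝓝 x₀, localBracket B P (p a) x = 0 := fun a ha ↦ by
    filter_upwards [hpP a ha, hB.bracket_skew P (p a)] with x h1 h2
    rw [h2, h1, neg_zero]
  -- The correction from `β` to `dh` is a combination of the `dq` and `dp`, all of which pair to
  -- zero with `dP`.
  have hne : localBracket B P h x₀ ≠ 0 := by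
    have hle : differentialSpan x₀ j q ⊔ differentialSpan x₀ j p ≤
        LinearMap.ker (B x₀ (fderiv ℝ P x₀)).toLinearMap := by
      refine sup_le (Submodule.span_le.mpr ?_) (Submodule.span_le.mpr ?_)
      · rintro _ ⟨a, rfl⟩
        exact (hPq a a.2).self_of_nhds
      · rintro _ ⟨a, rfl⟩
        exact (hPp a a.2).self_of_nhds
    have h0 : B x₀ (fderiv ℝ P x₀) (fderiv ℝ h x₀ - β) = 0 := hle hdh
    rw [map_sub, sub_eq_zero] at h0
    rwa [localBracket, h0]
  obtain ⟨τ, hτ, hPτ, hτ0⟩ := exists_time_function (hB.hamiltonianField_smooth hP) hh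
    (by rwa [fderiv_hamiltonianField])
  simp only [fderiv_hamiltonianField] at hPτ
  -- Here `τ` has initial value `0` on the level set of `h`, and `{P, τ} = 1` is constant. This is
  -- why `h` was made to commute with the earlier pairs.
  have hcomm : ∀ K, SmoothNear K x₀ → (∀ᶠ x in 𝓝 x₀, localBracket B K P x = 0) →
      (∀ᶠ x in 𝓝 x₀, localBracket B K h x = 0) → ∀ᶠ x in 𝓝 x₀, localBracket B K τ x = 0 :=
    fun K hK hKP hKh ↦ hB.bracket_eq_zero_of_initial hP hh hτ (.const 0) hK hne hPτ hτ0 hKP hKh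
      (Eventually.of_forall fun x ↦ localBracket_eq_zero_of_eventually_const
        (Eventually.of_forall fun _ ↦ rfl))
  have hneg : ∀ f x, localBracket B f (fun y ↦ -τ y) x = - localBracket B f τ x := fun f x ↦ by
    rw [localBracket, fderiv_fun_neg, map_neg, localBracket]
  -- The sign turns `{P, τ} = 1` into `{Q, P} = 1`.
  let Q : E → ℝ := fun y ↦ -τ y
  have hQ : SmoothNear Q x₀ := hτ.neg
  have hqQ : ∀ a < j, ∀ᶠ x in 𝓝 x₀, localBracket B (q a) Q x = 0 := fun a ha ↦ by
    filter_upwards [hcomm _ (H.smooth_q a ha) (hqP a ha) (hqh a ha)] with x hx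
    rw [hneg, hx, neg_zero]
  have hpQ : ∀ a < j, ∀ᶠ x in 𝓝 x₀, localBracket B (p a) Q x = 0 := fun a ha ↦ by
    filter_upwards [hcomm _ (H.smooth_p a ha) (hpP a ha) (hph a ha)] with x hx
    rw [hneg, hx, neg_zero]
  have hQP : ∀ᶠ x in 𝓝 x₀, localBracket B Q P x = 1 := by
    filter_upwards [hPτ, hB.bracket_skew Q P] with x h1 h2
    rw [h2, hneg, h1, neg_neg]
  have hswap : ∀ {f g : E → ℝ}, (∀ᶠ x in 𝓝 x₀, localBracket B f g x = 0) →
      ∀ᶠ x in 𝓝 x₀, localBracket B g f x = 0 := fun {f g} hfg ↦ by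
    filter_upwards [hfg, hB.bracket_skew g f] with x h1 h2
    rw [h2, h1, neg_zero]
  refine ⟨Function.update q j Q, Function.update p j P, ?_, ?_, ?_, ?_, ?_, ?_⟩
  · intro a ha
    rcases Nat.lt_succ_iff_lt_or_eq.mp ha with ha | rfl
    · simpa [ha.ne] using H.smooth_q a ha
    · simpa using hQ
  · intro a ha
    rcases Nat.lt_succ_iff_lt_or_eq.mp ha with ha | rfl
    · simpa [ha.ne] using H.smooth_p a ha
    · simpa using hP
  · intro a ha b hb
    rcases Nat.lt_succ_iff_lt_or_eq.mp ha with ha | rfl <;>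
      rcases Nat.lt_succ_iff_lt_or_eq.mp hb with hb | rfl
    · simpa [ha.ne, hb.ne] using H.bracket_qq a ha b hb
    · simpa [ha.ne] using hqQ a ha
    · simpa [hb.ne] using hswap (hqQ b hb)
    · simpa using hB.bracket_self Q
  · intro a ha b hb
    rcases Nat.lt_succ_iff_lt_or_eq.mp ha with ha | rfl <;>
      rcases Nat.lt_succ_iff_lt_or_eq.mp hb with hb | rfl
    · simpa [ha.ne, hb.ne] using H.bracket_pp a ha b hb
    · simpa [ha.ne] using hpP a ha
    · simpa [hb.ne] using hPp b hb
    · simpa using hB.bracket_self P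
  · intro a ha b hb
    rcases Nat.lt_succ_iff_lt_or_eq.mp ha with ha | rfl <;>
      rcases Nat.lt_succ_iff_lt_or_eq.mp hb with hb | rfl
    · simpa [ha.ne, hb.ne] using H.bracket_qp a ha b hb
    · simpa [ha.ne] using hqP a ha
    · simpa [hb.ne, hb.ne'] using hswap (hpQ b hb)
    · simpa using hQP
  · intro a ha
    rcases Nat.lt_succ_iff_lt_or_eq.mp ha with ha | rfl
    · simpa [ha.ne] using H.vanish_p a ha
    · simpa using hPV

end IsCanonicalSystem

theorem exists_isCanonicalSystem [FiniteDimensional ℝ E] (hB : IsPoissonNear B x₀)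
    (hV : IsCoisotropicNear B V x₀) (hx₀ : x₀ ∈ V)
    (hrank : ∀ α : E →L[ℝ] ℝ, (∀ v ∈ V, α v = 0) → (∀ β, B x₀ α β = 0) → α = 0) (j : ℕ)
    (hj : Module.finrank ℝ V + j ≤ Module.finrank ℝ E) :
    ∃ q p, IsCanonicalSystem B V x₀ j q p := by
  induction j with
  | zero => exact ⟨fun _ _ ↦ 0, fun _ _ ↦ 0, by constructor <;> simp⟩
  | succ j ih =>
    obtain ⟨q, p, H⟩ := ih (by omega)
    exact H.exists_extend hB hV hx₀ hrank (by omega)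

end LocalPoisson

/-! ### Completion of the canonical pairs to a frame; local equations of `V`. -/

section CanonicalChart

variable {E : Type*} [NormedAddCommGroup E] [NormedSpace ℝ E]
  {B : E → (E →L[ℝ] ℝ) →L[ℝ] (E →L[ℝ] ℝ) →L[ℝ] ℝ} {V : Submodule ℝ E} {x₀ : E} {k l : ℕ}

/-- Functions near `x₀` with independent differentials and canonical brackets, the `p`-functions
being equations of `V`. -/
structure IsCanonicalFrame (B : E → (E →L[ℝ] ℝ) →L[ℝ] (E →L[ℝ] ℝ) →L[ℝ] ℝ) (V : Submodule ℝ E)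
    (x₀ : E) (u : Fin k ⊕ Fin k ⊕ Fin l → E → ℝ) : Prop where
  smooth : ∀ a, SmoothNear (u a) x₀
  eq_zero_of_fderiv : ∀ v, (∀ a, fderiv ℝ (u a) x₀ v = 0) → v = 0
  bracket_qq : ∀ I J, ∀ᶠ x in 𝓝 x₀, localBracket B (u (iq I)) (u (iq J)) x = 0
  bracket_pp : ∀ I J, ∀ᶠ x in 𝓝 x₀, localBracket B (u (ip I)) (u (ip J)) x = 0
  bracket_qp : ∀ I J, ∀ᶠ x in 𝓝 x₀,
    localBracket B (u (iq I)) (u (ip J)) x = if I = J then 1 else 0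
  bracket_qy : ∀ I j, ∀ᶠ x in 𝓝 x₀, localBracket B (u (iq I)) (u (iy j)) x = 0
  bracket_py : ∀ I j, ∀ᶠ x in 𝓝 x₀, localBracket B (u (ip I)) (u (iy j)) x = 0
  vanish_p : ∀ I, ∀ᶠ x in 𝓝 x₀, x ∈ V → u (ip I) x = 0

/-- The matrix of brackets is symplectic: pairing a linear relation with `dp J` isolates the
coefficient of `dq J`, and conversely. -/
theorem IsCanonicalSystem.linearIndependent {q p : ℕ → E → ℝ}
    (H : IsCanonicalSystem B V x₀ k q p) (hB : IsPoissonNear B x₀) :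
    LinearIndependent ℝ (Sum.elim (fun I : Fin k ↦ fderiv ℝ (q I) x₀)
      (fun I : Fin k ↦ fderiv ℝ (p I) x₀)) := by
  rw [Fintype.linearIndependent_iff]
  intro c hc
  rw [Fintype.sum_sum_type] at hc
  simp only [Sum.elim_inl, Sum.elim_inr] at hc
  have e1 : ∀ f : ℕ → E → ℝ, ∀ J : Fin k,
      ∑ I : Fin k, c (Sum.inl I) * localBracket B (f J) (q I) x₀ +
        ∑ I : Fin k, c (Sum.inr I) * localBracket B (f J) (p I) x₀ = 0 := fun f J ↦ by
    simpa [localBracket] using congrArg (B x₀ (fderiv ℝ (f J) x₀)) hc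
  have e2 : ∀ I J : Fin k, localBracket B (q I) (q J) x₀ = 0 := fun I J ↦
    (H.bracket_qq I I.2 J J.2).self_of_nhds
  have e3 : ∀ I J : Fin k, localBracket B (p I) (p J) x₀ = 0 := fun I J ↦
    (H.bracket_pp I I.2 J J.2).self_of_nhds
  have e4 : ∀ I J : Fin k, localBracket B (q I) (p J) x₀ = if I = J then 1 else 0 := fun I J ↦ by
    simpa [Fin.ext_iff] using (H.bracket_qp I I.2 J J.2).self_of_nhds
  have e5 : ∀ I J : Fin k, localBracket B (p I) (q J) x₀ = if I = J then -1 else 0 := fun I J ↦ by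
    simpa [Fin.ext_iff] using (H.bracket_pq hB I.2 J.2).self_of_nhds
  rintro (J | J)
  · simpa [e3, e5] using e1 p J
  · simpa [e2, e4] using e1 q J

variable [FiniteDimensional ℝ E]

theorem exists_isCanonicalFrame (hB : IsPoissonNear B x₀) (hV : IsCoisotropicNear B V x₀)
    (hx₀ : x₀ ∈ V)
    (hrank : ∀ α : E →L[ℝ] ℝ, (∀ v ∈ V, α v = 0) → (∀ β, B x₀ α β = 0) → α = 0)
    (hdim : Module.finrank ℝ E = Module.finrank ℝ V + k) (hl : l = Module.finrank ℝ V - k) :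
    Module.finrank ℝ E = k + (k + l) ∧
      ∃ u : Fin k ⊕ Fin k ⊕ Fin l → E → ℝ, IsCanonicalFrame B V x₀ u := by
  obtain ⟨q, p, H⟩ := exists_isCanonicalSystem hB hV hx₀ hrank k hdim.ge
  have hli := H.linearIndependent hB
  set w := Sum.elim (fun I : Fin k ↦ fderiv ℝ (q I) x₀) (fun I : Fin k ↦ fderiv ℝ (p I) x₀) with hw
  have hW : Submodule.span ℝ (range w) = differentialSpan x₀ k q ⊔ differentialSpan x₀ k p := by
    rw [hw, Sum.elim_range, Submodule.span_union]
    rfl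
  have hdual : Module.finrank ℝ (E →L[ℝ] ℝ) = Module.finrank ℝ E := by
    rw [← (LinearMap.toContinuousLinearMap : (E →ₗ[ℝ] ℝ) ≃ₗ[ℝ] (E →L[ℝ] ℝ)).finrank_eq]
    exact Subspace.dual_finrank_eq
  have hcard := finrank_span_eq_card hli
  simp only [Fintype.card_sum, Fintype.card_fin] at hcard
  obtain ⟨W', hW'⟩ := Submodule.exists_isCompl (Submodule.span ℝ (range w))
  have hsum := Submodule.finrank_add_eq_of_isCompl hW'
  -- The `2k` independent differentials fit into a space of dimension `finrank V + k`, so `k ≤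
  -- finrank V` and the truncated subtraction in `hl` is exact.
  have hn : Module.finrank ℝ E = k + (k + l) := by omega
  have hfin : Module.finrank ℝ W' = l := by omega
  let b := Module.finBasisOfFinrankEq ℝ W' hfin
  -- The correction changes the differential of `b j` only modulo the span of the `dq` and `dp`, so
  -- all the differentials together still span the dual.
  have hy := fun j ↦ H.exists_commuting hB hV hx₀ (SmoothNear.clm (x := x₀) (b j : E →L[ℝ] ℝ))
  choose y hys hqy hpy hdy _ using hy
  refine ⟨hn, Sum.elim (fun I ↦ q I) (Sum.elim (fun I ↦ p I) y), ?_, ?_, ?_, ?_, ?_, ?_, ?_, ?_⟩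
  · rintro (I | I | j)
    exacts [H.smooth_q I I.2, H.smooth_p I I.2, hys j]
  · intro v hv
    let K : Submodule ℝ (E →L[ℝ] ℝ) := LinearMap.ker (ContinuousLinearMap.apply ℝ ℝ v).toLinearMap
    have hmem : ∀ α, α ∈ K ↔ α v = 0 := fun α ↦ Iff.rfl
    have h1 : Submodule.span ℝ (range w) ≤ K := by
      rw [Submodule.span_le]
      rintro _ ⟨I | I, rfl⟩
      exacts [hv (iq I), hv (ip I)]
    have h2 : W' ≤ K := by
      intro α hα
      have h4 : ∀ j, (b j : E →L[ℝ] ℝ) ∈ K := fun j ↦ by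
        have h5 := h1 (hW ▸ hdy j)
        rw [hmem, (b j : E →L[ℝ] ℝ).fderiv, _root_.sub_apply,
          show fderiv ℝ (y j) x₀ v = 0 from hv (iy j), zero_sub, neg_eq_zero] at h5
        exact h5
      have h6 : α = ∑ j, b.repr ⟨α, hα⟩ j • (b j : E →L[ℝ] ℝ) := by
        have := congrArg W'.subtype (b.sum_repr ⟨α, hα⟩)
        rw [map_sum] at this
        exact this.symm
      rw [h6]
      exact Submodule.sum_mem _ fun j _ ↦ Submodule.smul_mem _ _ (h4 j)
    have h7 : K = ⊤ := top_le_iff.mp (hW'.sup_eq_top ▸ sup_le h1 h2)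
    have h8 : v ∈ (⊥ : Submodule ℝ E) := mem_of_forall_annihilator fun α _ ↦
      (hmem α).mp (h7 ▸ Submodule.mem_top)
    simpa using h8
  · exact fun I J ↦ H.bracket_qq I I.2 J J.2
  · exact fun I J ↦ H.bracket_pp I I.2 J J.2
  · exact fun I J ↦ by simpa [Fin.ext_iff] using H.bracket_qp I I.2 J J.2
  · exact fun I j ↦ hqy j I I.2
  · exact fun I j ↦ hpy j I I.2
  · exact fun I ↦ H.vanish_p I I.2

/-- A linear subspace is locally the zero set of functions that vanish on it, are as many as its
codimension and have independent differentials. -/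
theorem mem_of_vanishing {p : Fin k → E → ℝ} (hx₀ : x₀ ∈ V) (hp : ∀ I, SmoothNear (p I) x₀)
    (hpV : ∀ I, ∀ᶠ x in 𝓝 x₀, x ∈ V → p I x = 0)
    (hsurj : ∀ c : Fin k → ℝ, ∃ v, ∀ I, fderiv ℝ (p I) x₀ v = c I)
    (hdim : Module.finrank ℝ E = Module.finrank ℝ V + k) :
    ∀ᶠ x in 𝓝 x₀, (∀ I, p I x = 0) → x ∈ V := by
  have : CompleteSpace E := FiniteDimensional.complete ℝ E
  let D : E →L[ℝ] (Fin k → ℝ) := ContinuousLinearMap.pi fun I ↦ fderiv ℝ (p I) x₀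
  have hD : LinearMap.range D.toLinearMap = ⊤ := LinearMap.range_eq_top.mpr fun c ↦ by
    obtain ⟨v, hv⟩ := hsurj c
    exact ⟨v, funext hv⟩
  have hVK : V = LinearMap.ker D.toLinearMap := by
    refine Submodule.eq_of_le_of_finrank_eq (fun v hv ↦ ?_) ?_
    · exact funext fun I ↦ (fderiv_eq_zero_of_vanishing (hp I) (hpV I)).self_of_nhds hx₀ v hv
    · have := LinearMap.finrank_range_add_finrank_ker D.toLinearMap
      rw [hD, finrank_top, Module.finrank_fin_fun] at this
      omega
  obtain ⟨s', hs'⟩ := D.toLinearMap.exists_rightInverse_of_surjective hD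
  let s : (Fin k → ℝ) →L[ℝ] E := LinearMap.toContinuousLinearMap s'
  have hs : ∀ c, D (s c) = c := fun c ↦ DFunLike.congr_fun hs' c
  let π : E →L[ℝ] E := ContinuousLinearMap.id ℝ E - s ∘L D
  have hπ : ∀ v, π v = v - s (D v) := fun v ↦ rfl
  have hDπ : ∀ v, D (π v) = 0 := fun v ↦ by rw [hπ, map_sub, hs, sub_self]
  have hπV : ∀ v, π v ∈ V := fun v ↦ by rw [hVK]; exact hDπ v
  have hπx₀ : π x₀ = x₀ := by
    have : D x₀ = 0 := by rw [hVK] at hx₀; exact hx₀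
    rw [hπ, this, map_zero, sub_zero]
  have hps : SmoothNear (fun x I ↦ p I x) x₀ := by
    filter_upwards [eventually_all.mpr hp] with x hx using contDiffAt_pi.mpr hx
  have hpd : HasFDerivAt (fun x I ↦ p I x) D x₀ := hasFDerivAt_pi.mpr fun I ↦ (hp I).hasFDerivAt
  -- This map has derivative the identity at `x₀`, hence is injective nearby. If all `p I` vanish at
  -- `x`, then `x` and its projection `π x ∈ V` have the same image, so `x = π x`.
  have hΞ : SmoothNear (fun x ↦ π x + s (fun I ↦ p I x)) x₀ :=
    (SmoothNear.clm π).add (SmoothNear.comp (g := s) (.clm s) hps)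
  have hΞd : HasFDerivAt (fun x ↦ π x + s (fun I ↦ p I x)) (π + s ∘L D) x₀ :=
    π.hasFDerivAt.add (s.hasFDerivAt.comp x₀ hpd)
  obtain ⟨Φ, hΦ, hmem, -⟩ := hΞ.exists_openPartialHomeomorph (ContinuousLinearEquiv.refl ℝ E) (by
    rw [hΞd.fderiv]; ext v; simp [π])
  have hπt : Tendsto π (𝓝 x₀) (𝓝 x₀) := by simpa only [hπx₀] using π.continuous.tendsto x₀
  have hsrc := Φ.open_source.mem_nhds hmem
  filter_upwards [hsrc, hπt.eventually hsrc, hπt.eventually (eventually_all.mpr hpV)]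
    with x h1 h2 h3 h4
  have h5 : (fun I ↦ p I x) = 0 := funext h4
  have h6 : (fun I ↦ p I (π x)) = 0 := funext fun I ↦ h3 I (hπV x)
  have h7 : x = π x := by
    refine Φ.injOn h1 h2 ?_
    simp only [hΦ, h5, h6]
    rw [hπ (π x), hDπ, map_zero, sub_zero]
  rw [h7]
  exact hπV x

end CanonicalChart

/-! ### Expansion of a bivector in a coordinate frame; dependence on `y` alone. -/

section CanonicalChart

variable {E : Type*} [NormedAddCommGroup E] [NormedSpace ℝ E]
  {B : E → (E →L[ℝ] ℝ) →L[ℝ] (E →L[ℝ] ℝ) →L[ℝ] ℝ} {V : Submodule ℝ E} {x₀ : E} {k l : ℕ}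

theorem coordSpace_eq_sum {ι : Type*} [Fintype ι] [DecidableEq ι] (z : EuclideanSpace ℝ ι) :
    z = ∑ a, z a • EuclideanSpace.single a (1 : ℝ) := by
  ext b
  simp [Pi.single_apply]

/-- The vectors `∂_a` of the coordinate system `e`. -/
def frameVec (e : OpenPartialHomeomorph E (CoordSpace k l)) (a : Fin k ⊕ Fin k ⊕ Fin l)
    (z : CoordSpace k l) : E :=
  fderiv ℝ e.symm z (EuclideanSpace.single a (1 : ℝ))

/-- The expansion of a vector in the coordinate frame. -/
theorem eq_sum_frameVec {e : OpenPartialHomeomorph E (CoordSpace k l)}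
    {u : Fin k ⊕ Fin k ⊕ Fin l → E → ℝ} (heu : ∀ x a, e x a = u a x)
    (he : ContDiffOn ℝ ∞ e e.source) (he' : ContDiffOn ℝ ∞ e.symm e.target)
    {z : CoordSpace k l} (hz : z ∈ e.target) (v : E) :
    v = ∑ a, fderiv ℝ (u a) (e.symm z) v • frameVec e a z := by
  have hx := e.map_target hz
  have h1 : DifferentiableAt ℝ e (e.symm z) :=
    (he.contDiffAt (e.open_source.mem_nhds hx)).differentiableAt (by simp)
  have h2 : DifferentiableAt ℝ e.symm (e (e.symm z)) := by
    rw [e.right_inv hz]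
    exact (he'.contDiffAt (e.open_target.mem_nhds hz)).differentiableAt (by simp)
  have h3 : HasFDerivAt (fun y ↦ e.symm (e y)) (ContinuousLinearMap.id ℝ E) (e.symm z) := by
    refine (hasFDerivAt_id _).congr_of_eventuallyEq ?_
    filter_upwards [e.open_source.mem_nhds hx] with y hy using e.left_inv hy
  have h4 := fderiv_comp_eq h2 h1 v
  rw [h3.fderiv, e.right_inv hz] at h4
  have h5 : ∀ a, fderiv ℝ e (e.symm z) v a = fderiv ℝ (u a) (e.symm z) v := fun a ↦ by
    have := fderiv_comp_eq (g := (EuclideanSpace.proj a : CoordSpace k l →L[ℝ] ℝ)) (f := e)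
      (ContinuousLinearMap.differentiableAt _) h1 v
    rw [ContinuousLinearMap.fderiv] at this
    refine (show _ = _ from this.symm).trans ?_
    have h6 : (fun y ↦ ((EuclideanSpace.proj a : CoordSpace k l →L[ℝ] ℝ)) (e y)) = u a :=
      funext fun y ↦ heu y a
    rw [h6]
  have h6 := coordSpace_eq_sum (fderiv ℝ e (e.symm z) v)
  simp only [h5] at h6
  rw [h6, map_sum] at h4
  simpa [frameVec] using h4

/-- The expansion of a bivector in a canonical frame. -/
theorem bivector_expansion {b : (E →L[ℝ] ℝ) →L[ℝ] (E →L[ℝ] ℝ) →L[ℝ] ℝ}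
    {D : Fin k ⊕ Fin k ⊕ Fin l → E} {θ : Fin k ⊕ Fin k ⊕ Fin l → E →L[ℝ] ℝ}
    (hD : ∀ v, v = ∑ a, θ a v • D a) (hskew : ∀ α β, b α β = - b β α)
    (hqq : ∀ I J, b (θ (iq I)) (θ (iq J)) = 0) (hpp : ∀ I J, b (θ (ip I)) (θ (ip J)) = 0)
    (hqp : ∀ I J, b (θ (iq I)) (θ (ip J)) = if I = J then 1 else 0)
    (hqy : ∀ I j, b (θ (iq I)) (θ (iy j)) = 0) (hpy : ∀ I j, b (θ (ip I)) (θ (iy j)) = 0)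
    (α β : E →L[ℝ] ℝ) :
    b α β = (∑ I : Fin k, (α (D (iq I)) * β (D (ip I)) - α (D (ip I)) * β (D (iq I)))) +
      ∑ i : Fin l, ∑ j : Fin l, (b (θ (iy i)) (θ (iy j)) / 2) *
        (α (D (iy i)) * β (D (iy j)) - α (D (iy j)) * β (D (iy i))) := by
  have hexp : ∀ γ : E →L[ℝ] ℝ, γ = ∑ a, γ (D a) • θ a := fun γ ↦ by
    ext v
    conv_lhs => rw [hD v, map_sum]
    simp [mul_comm]
  have h1 : b α β = ∑ a, ∑ c, α (D a) * (β (D c) * b (θ a) (θ c)) := by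
    conv_lhs => rw [hexp α, hexp β]
    rw [map_sum b, _root_.sum_apply]
    refine Finset.sum_congr rfl fun a _ ↦ ?_
    rw [map_smul, _root_.smul_apply, map_sum, smul_eq_mul, Finset.mul_sum]
    refine Finset.sum_congr rfl fun c _ ↦ ?_
    rw [map_smul, smul_eq_mul]
  have hpq : ∀ I J, b (θ (ip I)) (θ (iq J)) = if I = J then -1 else 0 := fun I J ↦ by
    rw [hskew, hqp]
    by_cases h : I = J
    · simp [h]
    · simp [h, Ne.symm h]
  have hyq : ∀ I j, b (θ (iy j)) (θ (iq I)) = 0 := fun I j ↦ by rw [hskew, hqy, neg_zero]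
  have hyp : ∀ I j, b (θ (iy j)) (θ (ip I)) = 0 := fun I j ↦ by rw [hskew, hpy, neg_zero]
  rw [h1]
  simp only [Fintype.sum_sum_type, hqq, hpp, hqp, hqy, hpy, hpq, hyq, hyp, mul_zero, mul_ite,
    mul_one, mul_neg, Finset.sum_const_zero, zero_add, add_zero, Finset.sum_ite_eq,
    Finset.mem_univ, if_true]
  -- The double sum of wedges counts each unordered pair twice; hence the factor `1 / 2`.
  have h2 : ∑ i : Fin l, ∑ j : Fin l, (b (θ (iy i)) (θ (iy j)) / 2) *
        (α (D (iy i)) * β (D (iy j)) - α (D (iy j)) * β (D (iy i))) =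
      ∑ i : Fin l, ∑ j : Fin l, α (D (iy i)) * (β (D (iy j)) * b (θ (iy i)) (θ (iy j))) := by
    have h3 : ∑ i : Fin l, ∑ j : Fin l, (b (θ (iy i)) (θ (iy j)) / 2) *
        (α (D (iy j)) * β (D (iy i))) = - ∑ i : Fin l, ∑ j : Fin l,
          (b (θ (iy i)) (θ (iy j)) / 2) * (α (D (iy i)) * β (D (iy j))) := by
      rw [Finset.sum_comm, ← Finset.sum_neg_distrib]
      refine Finset.sum_congr rfl fun i _ ↦ ?_
      rw [← Finset.sum_neg_distrib]
      refine Finset.sum_congr rfl fun j _ ↦ ?_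
      rw [hskew]
      ring
    simp only [mul_sub, Finset.sum_sub_distrib]
    rw [h3, sub_neg_eq_add, ← Finset.sum_add_distrib]
    refine Finset.sum_congr rfl fun i _ ↦ ?_
    rw [← Finset.sum_add_distrib]
    refine Finset.sum_congr rfl fun j _ ↦ ?_
    ring
  rw [h2, ← add_assoc, ← Finset.sum_add_distrib]
  simp only [sub_eq_add_neg]

/-- The point with the `q`- and `p`-coordinates of `z₀` and the `y`-coordinates `y`. -/
def withYPart (z₀ : CoordSpace k l) (y : EuclideanSpace ℝ (Fin l)) : CoordSpace k l :=
  WithLp.toLp 2 (Sum.elim (fun I ↦ z₀ (iq I)) (Sum.elim (fun I ↦ z₀ (ip I)) (fun j ↦ y j)))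

theorem contDiff_withYPart (z₀ : CoordSpace k l) : ContDiff ℝ ∞ (withYPart z₀) := by
  refine contDiff_euclidean.mpr fun a ↦ ?_
  rcases a with I | I | j
  · exact contDiff_const
  · exact contDiff_const
  · exact (EuclideanSpace.proj j : EuclideanSpace ℝ (Fin l) →L[ℝ] ℝ).contDiff

theorem withYPart_yPart_self (z₀ : CoordSpace k l) : withYPart z₀ (yPart z₀) = z₀ := by
  ext a
  rcases a with I | I | j <;> rfl

theorem continuous_yPart : Continuous (yPart : CoordSpace k l → EuclideanSpace ℝ (Fin l)) := by
  unfold yPart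
  fun_prop

/-- Resetting the `q`- and `p`-coordinates to those of the centre keeps a point in a ball, so the
segment to the reset point stays there as well. -/
theorem dist_withYPart_le (z z₀ : CoordSpace k l) :
    dist (withYPart z₀ (yPart z)) z₀ ≤ dist z z₀ := by
  rw [EuclideanSpace.dist_eq, EuclideanSpace.dist_eq]
  refine Real.sqrt_le_sqrt (Finset.sum_le_sum fun a _ ↦ ?_)
  rcases a with I | I | j
  · simp [withYPart]
  · simp [withYPart]
  · simp [withYPart, yPart]

/-- A function whose derivatives in the `q`- and `p`-directions vanish on a ball only depends on
the `y`-coordinates there. -/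
theorem eq_withYPart_of_fderiv {g : CoordSpace k l → ℝ} {z₀ : CoordSpace k l} {r : ℝ}
    (hg : ∀ z ∈ Metric.ball z₀ r, DifferentiableAt ℝ g z)
    (hq : ∀ z ∈ Metric.ball z₀ r, ∀ I, fderiv ℝ g z (EuclideanSpace.single (iq I) 1) = 0)
    (hp : ∀ z ∈ Metric.ball z₀ r, ∀ I, fderiv ℝ g z (EuclideanSpace.single (ip I) 1) = 0)
    {z : CoordSpace k l} (hz : z ∈ Metric.ball z₀ r) : g z = g (withYPart z₀ (yPart z)) := by
  set z' := withYPart z₀ (yPart z) with hz'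
  have hz'b : z' ∈ Metric.ball z₀ r := lt_of_le_of_lt (dist_withYPart_le z z₀) hz
  have hseg : ∀ t ∈ Icc (0 : ℝ) 1, z' + t • (z - z') ∈ Metric.ball z₀ r := fun t ht ↦ by
    have := (convex_ball z₀ r).add_smul_sub_mem hz'b hz ht
    exact this
  have hd : ∀ t ∈ Icc (0 : ℝ) 1, HasDerivAt (fun t : ℝ ↦ g (z' + t • (z - z'))) 0 t := by
    intro t ht
    have h1 : HasDerivAt (fun t : ℝ ↦ z' + t • (z - z')) (z - z') t := by
      simpa using ((hasDerivAt_id t).smul_const (z - z')).const_add z'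
    have h2 := (hg _ (hseg t ht)).hasFDerivAt.comp_hasDerivAt t h1
    have h3 : fderiv ℝ g (z' + t • (z - z')) (z - z') = 0 := by
      refine (congrArg _ (coordSpace_eq_sum (z - z'))).trans ?_
      rw [map_sum]
      refine Finset.sum_eq_zero fun a _ ↦ ?_
      rw [map_smul]
      rcases a with I | I | j
      · rw [hq _ (hseg t ht), smul_zero]
      · rw [hp _ (hseg t ht), smul_zero]
      · simp [hz', withYPart, yPart]
    rw [h3] at h2
    exact h2
  have := constant_of_has_deriv_right_zero
    (fun t ht ↦ (hd t ht).continuousAt.continuousWithinAt)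
    (fun t ht ↦ (hd t (Ico_subset_Icc_self ht)).hasDerivWithinAt) 1 (by simp)
  simpa using this

variable [FiniteDimensional ℝ E]

theorem IsCanonicalFrame.exists_chart {u : Fin k ⊕ Fin k ⊕ Fin l → E → ℝ}
    (H : IsCanonicalFrame B V x₀ u) (hn : Module.finrank ℝ E = k + (k + l)) :
    ∃ e : OpenPartialHomeomorph E (CoordSpace k l), x₀ ∈ e.source ∧ (∀ x a, e x a = u a x) ∧
      ContDiffOn ℝ ∞ e e.source ∧ ContDiffOn ℝ ∞ e.symm e.target := by
  have : CompleteSpace E := FiniteDimensional.complete ℝ E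
  let Ψ : E → CoordSpace k l := fun x ↦ WithLp.toLp 2 fun a ↦ u a x
  have hΨ : SmoothNear Ψ x₀ := by
    filter_upwards [eventually_all.mpr H.smooth] with x hx
    exact contDiffAt_euclidean.mpr hx
  have hd : ∀ v a, fderiv ℝ Ψ x₀ v a = fderiv ℝ (u a) x₀ v := fun v a ↦ by
    have := fderiv_comp_eq (g := (EuclideanSpace.proj a : CoordSpace k l →L[ℝ] ℝ)) (f := Ψ)
      (ContinuousLinearMap.differentiableAt _) hΨ.differentiableAt v
    rw [ContinuousLinearMap.fderiv] at this
    exact this.symm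
  have hinj : Function.Injective (fderiv ℝ Ψ x₀).toLinearMap := by
    rw [injective_iff_map_eq_zero]
    intro v hv
    refine H.eq_zero_of_fderiv v fun a ↦ ?_
    rw [← hd]
    exact congrArg (fun z : CoordSpace k l ↦ z a) hv
  let L := ((fderiv ℝ Ψ x₀).toLinearMap.linearEquivOfInjective hinj
    (by simp [hn])).toContinuousLinearEquiv
  obtain ⟨e, he, hx, h1, h2⟩ := hΨ.exists_openPartialHomeomorph L (by ext v; rfl)
  exact ⟨e, hx, fun x a ↦ by rw [he], by rwa [he], h2⟩

end CanonicalChart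

/-! ### Canonical coordinates in the linear model. -/

section CanonicalChart

variable {E : Type*} [NormedAddCommGroup E] [NormedSpace ℝ E]
  {B : E → (E →L[ℝ] ℝ) →L[ℝ] (E →L[ℝ] ℝ) →L[ℝ] ℝ} {V : Submodule ℝ E} {x₀ : E} {k l : ℕ}

theorem IsCanonicalFrame.bracket_pq {u : Fin k ⊕ Fin k ⊕ Fin l → E → ℝ}
    (H : IsCanonicalFrame B V x₀ u) (hB : IsPoissonNear B x₀) (I J : Fin k) :
    ∀ᶠ x in 𝓝 x₀, localBracket B (u (ip I)) (u (iq J)) x = if I = J then -1 else 0 := by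
  filter_upwards [H.bracket_qp J I, hB.bracket_skew (u (ip I)) (u (iq J))] with x h1 h2
  rw [h2, h1]
  by_cases h : I = J
  · simp [h]
  · simp [h, Ne.symm h]

/-- The brackets of the `y`-functions commute with the `q`- and `p`-functions. -/
theorem IsCanonicalFrame.bracket_bracket_yy {u : Fin k ⊕ Fin k ⊕ Fin l → E → ℝ}
    (H : IsCanonicalFrame B V x₀ u) (hB : IsPoissonNear B x₀) {a : Fin k ⊕ Fin k ⊕ Fin l}
    (ha : ∀ j, ∀ᶠ x in 𝓝 x₀, localBracket B (u a) (u (iy j)) x = 0) (i j : Fin l) :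
    ∀ᶠ x in 𝓝 x₀, localBracket B (u a) (localBracket B (u (iy i)) (u (iy j))) x = 0 := by
  filter_upwards [hB.bracket_comm (H.smooth a) (H.smooth (iy i)) (H.smooth (iy j)) (ha i),
    (ha j).eventually_nhds] with x h1 h2
  rw [h1, localBracket_eq_zero_of_eventually_const h2]

variable [FiniteDimensional ℝ E]

/-- Canonical coordinates near a point of a coisotropic linear subspace. -/
theorem exists_canonical_chart (hB : IsPoissonNear B x₀) (hV : IsCoisotropicNear B V x₀)
    (hx₀ : x₀ ∈ V)
    (hrank : ∀ α : E →L[ℝ] ℝ, (∀ v ∈ V, α v = 0) → (∀ β, B x₀ α β = 0) → α = 0)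
    (hdim : Module.finrank ℝ E = Module.finrank ℝ V + k) (hl : l = Module.finrank ℝ V - k)
    {U : Set E} (hU : U ∈ 𝓝 x₀) :
    ∃ e : OpenPartialHomeomorph E (CoordSpace k l), x₀ ∈ e.source ∧ e.source ⊆ U ∧
      ContDiffOn ℝ ∞ e e.source ∧ ContDiffOn ℝ ∞ e.symm e.target ∧
      (∀ x ∈ e.source, x ∈ V ↔ ∀ I : Fin k, e x (ip I) = 0) ∧
      ∃ φ : Fin l → Fin l → EuclideanSpace ℝ (Fin l) → ℝ, (∀ i j, ContDiff ℝ ∞ (φ i j)) ∧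
        ∀ z ∈ e.target, ∀ α β : E →L[ℝ] ℝ, B (e.symm z) α β =
          (∑ I : Fin k, (α (frameVec e (iq I) z) * β (frameVec e (ip I) z) -
            α (frameVec e (ip I) z) * β (frameVec e (iq I) z))) +
          ∑ i : Fin l, ∑ j : Fin l, φ i j (yPart z) *
            (α (frameVec e (iy i) z) * β (frameVec e (iy j) z) -
              α (frameVec e (iy j) z) * β (frameVec e (iy i) z)) := by
  obtain ⟨hn, u, H⟩ := exists_isCanonicalFrame hB hV hx₀ hrank hdim hl
  obtain ⟨e, hxe, heu, he, he'⟩ := H.exists_chart hn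
  have hz₀ := e.map_source hxe
  set z₀ := e x₀ with hz₀_def
  have hsymm0 : e.symm z₀ = x₀ := e.left_inv hxe
  have hcont : Tendsto e.symm (𝓝 z₀) (𝓝 x₀) := by
    simpa only [hsymm0] using (e.continuousAt_symm hz₀).tendsto
  have hds : SmoothNear e.symm z₀ := .of_contDiffOn e.open_target hz₀ he'
  let G : Fin l → Fin l → E → ℝ := fun i j ↦ localBracket B (u (iy i)) (u (iy j))
  have hG : ∀ i j, SmoothNear (G i j) x₀ := fun i j ↦
    hB.bracket_smooth (H.smooth (iy i)) (H.smooth (iy j))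
  let g : Fin l → Fin l → CoordSpace k l → ℝ := fun i j z ↦ G i j (e.symm z)
  have hg : ∀ i j, SmoothNear (g i j) z₀ := fun i j ↦
    SmoothNear.comp (by rw [hsymm0]; exact hG i j) hds
  have hframe : ∀ z ∈ e.target, ∀ v, v = ∑ a, fderiv ℝ (u a) (e.symm z) v • frameVec e a z :=
    fun z hz v ↦ eq_sum_frameVec heu he he' hz v
  have hdg : ∀ z ∈ e.target, ∀ i j, DifferentiableAt ℝ (G i j) (e.symm z) → ∀ a,
      fderiv ℝ (g i j) z (EuclideanSpace.single a 1) =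
        fderiv ℝ (G i j) (e.symm z) (frameVec e a z) := fun z hz i j hGz a ↦
    fderiv_comp_eq hGz ((he'.contDiffAt (e.open_target.mem_nhds hz)).differentiableAt (by simp)) _
  have htgt := e.open_target.mem_nhds hz₀
  -- The bracket relations say that the Hamiltonian field of `q_I` is `∂_{p_I}`, and below that the
  -- field of `p_I` is `-∂_{q_I}`; both annihilate `{y_i, y_j}`.
  have hgp : ∀ i j I, ∀ᶠ z in 𝓝 z₀, fderiv ℝ (g i j) z (EuclideanSpace.single (ip I) 1) = 0 := by
    intro i j I
    filter_upwards [htgt, hcont.eventually (H.bracket_bracket_yy hB (H.bracket_qy I) i j),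
      hcont.eventually (hG i j), hcont.eventually (eventually_all.mpr (H.bracket_qq I)),
      hcont.eventually (eventually_all.mpr (H.bracket_qp I)),
      hcont.eventually (eventually_all.mpr (H.bracket_qy I))] with z hz h1 h2 h3 h4 h5
    rw [hdg z hz i j (h2.differentiableAt (by simp))]
    have h6 := hframe z hz (hamiltonianField B (u (iq I)) (e.symm z))
    simp only [fderiv_hamiltonianField, Fintype.sum_sum_type, h3, h4, h5, zero_smul, ite_smul,
      one_smul, Finset.sum_const_zero, zero_add, add_zero, Finset.sum_ite_eq, Finset.mem_univ,
      if_true] at h6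
    change fderiv ℝ (G i j) (e.symm z) (frameVec e (Sum.inr (Sum.inl I)) z) = 0
    rw [← h6, fderiv_hamiltonianField]
    exact h1
  have hgq : ∀ i j I, ∀ᶠ z in 𝓝 z₀, fderiv ℝ (g i j) z (EuclideanSpace.single (iq I) 1) = 0 := by
    intro i j I
    filter_upwards [htgt, hcont.eventually (H.bracket_bracket_yy hB (H.bracket_py I) i j),
      hcont.eventually (hG i j), hcont.eventually (eventually_all.mpr (H.bracket_pp I)),
      hcont.eventually (eventually_all.mpr (H.bracket_pq hB I)),
      hcont.eventually (eventually_all.mpr (H.bracket_py I))] with z hz h1 h2 h3 h4 h5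
    rw [hdg z hz i j (h2.differentiableAt (by simp))]
    have h6 := hframe z hz (hamiltonianField B (u (ip I)) (e.symm z))
    simp only [fderiv_hamiltonianField, Fintype.sum_sum_type, h3, h4, h5, zero_smul, ite_smul,
      neg_smul, one_smul, Finset.sum_const_zero, add_zero, Finset.sum_ite_eq, Finset.mem_univ,
      if_true] at h6
    change fderiv ℝ (G i j) (e.symm z) (frameVec e (Sum.inl I) z) = 0
    rw [← neg_eq_zero, ← map_neg, ← h6, fderiv_hamiltonianField]
    exact h1
  -- The coefficients are evaluated on the slice through `z₀` with `q` and `p` frozen, then cut off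
  -- to be smooth on all of `ℝˡ`.
  have hφ : ∀ i j, ∃ φ : EuclideanSpace ℝ (Fin l) → ℝ, ContDiff ℝ ∞ φ ∧
      φ =ᶠ[𝓝 (yPart z₀)] fun y ↦ g i j (withYPart z₀ y) / 2 := fun i j ↦ by
    refine SmoothNear.exists_contDiff ?_
    have h1 : SmoothNear (fun y ↦ g i j (withYPart z₀ y)) (yPart z₀) :=
      SmoothNear.comp (by rw [withYPart_yPart_self]; exact hg i j)
        (.of_contDiff (contDiff_withYPart z₀))
    filter_upwards [h1] with y hy using hy.div_const 2
  choose φ hφs hφg using hφ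
  have hsurj : ∀ c : Fin k → ℝ, ∃ v, ∀ I, fderiv ℝ (u (ip I)) x₀ v = c I := by
    intro c
    refine ⟨fderiv ℝ e.symm z₀ (WithLp.toLp 2 (Sum.elim 0 (Sum.elim c 0))), fun I ↦ ?_⟩
    have h1 : (fun z ↦ u (ip I) (e.symm z)) =ᶠ[𝓝 z₀]
        (EuclideanSpace.proj (ip I) : CoordSpace k l →L[ℝ] ℝ) := by
      filter_upwards [htgt] with z hz
      rw [← heu, e.right_inv hz]
      rfl
    have h2 := fderiv_comp_eq (g := u (ip I)) (f := e.symm) (x := z₀)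
      (by rw [hsymm0]; exact (H.smooth _).differentiableAt) hds.differentiableAt
      (WithLp.toLp 2 (Sum.elim 0 (Sum.elim c 0)))
    rw [h1.fderiv_eq, ContinuousLinearMap.fderiv, hsymm0] at h2
    exact h2.symm
  have hpV := mem_of_vanishing hx₀ (fun I ↦ H.smooth (ip I)) H.vanish_p hsurj hdim
  have hall : ∀ᶠ z in 𝓝 z₀, (e.symm z ∈ U) ∧
      ((∀ I : Fin k, u (ip I) (e.symm z) = 0) → e.symm z ∈ V) ∧
      (∀ I : Fin k, e.symm z ∈ V → u (ip I) (e.symm z) = 0) ∧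
      (∀ i j, DifferentiableAt ℝ (g i j) z) ∧
      (∀ i j I, fderiv ℝ (g i j) z (EuclideanSpace.single (ip I) 1) = 0) ∧
      (∀ i j I, fderiv ℝ (g i j) z (EuclideanSpace.single (iq I) 1) = 0) ∧
      (∀ i j, φ i j (yPart z) = g i j (withYPart z₀ (yPart z)) / 2) ∧
      (∀ α β, B (e.symm z) α β = - B (e.symm z) β α) ∧
      (∀ I J, localBracket B (u (iq I)) (u (iq J)) (e.symm z) = 0) ∧
      (∀ I J, localBracket B (u (ip I)) (u (ip J)) (e.symm z) = 0) ∧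
      (∀ I J, localBracket B (u (iq I)) (u (ip J)) (e.symm z) = if I = J then 1 else 0) ∧
      (∀ I j, localBracket B (u (iq I)) (u (iy j)) (e.symm z) = 0) ∧
      (∀ I j, localBracket B (u (ip I)) (u (iy j)) (e.symm z) = 0) := by
    simp only [eventually_and, eventually_all]
    refine ⟨hcont.eventually hU, hcont.eventually hpV, fun I ↦ hcont.eventually (H.vanish_p I),
      fun i j ↦ (hg i j).mono fun z hz ↦ hz.differentiableAt (by simp), hgp, hgq,
      fun i j ↦ (continuous_yPart.tendsto z₀).eventually (hφg i j), ?_,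
      fun I J ↦ hcont.eventually (H.bracket_qq I J), fun I J ↦ hcont.eventually (H.bracket_pp I J),
      fun I J ↦ hcont.eventually (H.bracket_qp I J), fun I J ↦ hcont.eventually (H.bracket_qy I J),
      fun I J ↦ hcont.eventually (H.bracket_py I J)⟩
    have := hcont.eventually hB.skew
    filter_upwards [this] with z hz using hz
  obtain ⟨r, hr, hball⟩ := Metric.eventually_nhds_iff_ball.mp hall
  -- The restriction is made on the coordinate side, so that the target lies in a Euclidean ball, as
  -- `eq_withYPart_of_fderiv` requires.
  let e₁ := (e.symm.restrOpen (Metric.ball z₀ r) Metric.isOpen_ball).symm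
  have hsrc : ∀ {x}, x ∈ e₁.source → x ∈ e.source ∧ e x ∈ Metric.ball z₀ r := fun {x} hx ↦ by
    have h1 := e₁.map_source hx
    exact ⟨hx.1, h1.2⟩
  have htgt₁ : ∀ {z}, z ∈ e₁.target → z ∈ e.target ∧ z ∈ Metric.ball z₀ r := fun {z} hz ↦ hz
  have hx₁ : x₀ ∈ e₁.source := by
    have h1 : z₀ ∈ e₁.target := ⟨hz₀, Metric.mem_ball_self hr⟩
    have h2 := e₁.map_target h1
    have h3 : e₁.symm z₀ = x₀ := hsymm0
    rwa [h3] at h2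
  refine ⟨e₁, hx₁, fun x hx ↦ ?_, he.mono fun x hx ↦ (hsrc hx).1,
    he'.mono fun z hz ↦ (htgt₁ hz).1, fun x hx ↦ ?_, φ, hφs, fun z hz α β ↦ ?_⟩
  · have := (hball _ (hsrc hx).2).1
    rwa [e.left_inv (hsrc hx).1] at this
  · obtain ⟨-, h1, h2, -⟩ := hball _ (hsrc hx).2
    rw [e.left_inv (hsrc hx).1] at h1 h2
    have h3 : ∀ I : Fin k, e₁ x (ip I) = u (ip I) x := fun I ↦ heu x (ip I)
    simp only [h3]
    exact ⟨fun h I ↦ h2 I h, h1⟩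
  · obtain ⟨hzt, hzb⟩ := htgt₁ hz
    obtain ⟨-, -, -, -, -, -, h1, hsk, hqq, hpp, hqp, hqy, hpy⟩ := hball z hzb
    have h2 := bivector_expansion (b := B (e.symm z)) (D := fun a ↦ frameVec e a z)
      (θ := fun a ↦ fderiv ℝ (u a) (e.symm z)) (hframe z hzt) hsk hqq hpp hqp hqy hpy α β
    refine h2.trans (congrArg₂ (· + ·) rfl ?_)
    refine Finset.sum_congr rfl fun i _ ↦ Finset.sum_congr rfl fun j _ ↦ ?_
    have h3 := eq_withYPart_of_fderiv (g := g i j)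
      (fun w hw ↦ (hball w hw).2.2.2.1 i j) (fun w hw ↦ (hball w hw).2.2.2.2.2.1 i j)
      (fun w hw ↦ (hball w hw).2.2.2.2.1 i j) hzb
    rw [h1, ← h3]
    rfl

end CanonicalChart

/-! ### Bivector fields on a manifold read in a chart. -/

section ChartBivector

variable {n : ℕ} {P : Type*} [TopologicalSpace P]
  [ChartedSpace (EuclideanSpace ℝ (Fin n)) P]
  {φ : OpenPartialHomeomorph P (EuclideanSpace ℝ (Fin n))}

theorem mdifferentiable_chart (hφ : φ ∈ IsManifold.maximalAtlas (𝓡 n) ∞ P) :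
    φ.MDifferentiable (𝓡 n) 𝓘(ℝ, EuclideanSpace ℝ (Fin n)) :=
  ⟨(contMDiffOn_of_mem_maximalAtlas hφ).mdifferentiableOn (by simp),
    (contMDiffOn_symm_of_mem_maximalAtlas hφ).mdifferentiableOn (by simp)⟩

theorem contMDiffAt_comp_chart (hφ : φ ∈ IsManifold.maximalAtlas (𝓡 n) ∞ P) {x : P}
    (hx : x ∈ φ.source) {f : EuclideanSpace ℝ (Fin n) → ℝ} (hf : ContDiffAt ℝ ∞ f (φ x)) :
    ContMDiffAt (𝓡 n) 𝓘(ℝ, ℝ) ∞ (fun y ↦ f (φ y)) x :=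
  ContMDiffAt.comp x hf.contMDiffAt
    ((contMDiffOn_of_mem_maximalAtlas hφ).contMDiffAt (φ.open_source.mem_nhds hx))

theorem mvfderiv_comp_chart (hφ : φ ∈ IsManifold.maximalAtlas (𝓡 n) ∞ P) {x : P}
    (hx : x ∈ φ.source) {f : EuclideanSpace ℝ (Fin n) → ℝ} (hf : DifferentiableAt ℝ f (φ x)) :
    mvfderiv (𝓡 n) (fun y ↦ f (φ y)) x =
      fderiv ℝ f (φ x) ∘L mfderiv (𝓡 n) 𝓘(ℝ, EuclideanSpace ℝ (Fin n)) φ x := by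
  have h1 : mfderiv (𝓡 n) 𝓘(ℝ, ℝ) (f ∘ φ) x = (mfderiv 𝓘(ℝ, EuclideanSpace ℝ (Fin n)) 𝓘(ℝ, ℝ)
      f (φ x)).comp (mfderiv (𝓡 n) 𝓘(ℝ, EuclideanSpace ℝ (Fin n)) φ x) :=
    mfderiv_comp x hf.mdifferentiableAt ((mdifferentiable_chart hφ).mdifferentiableAt hx)
  rw [mfderiv_eq_fderiv] at h1
  exact h1

variable [IsManifold (𝓡 n) ∞ P]

/-- The differential of a smooth function is a smooth section of the cotangent bundle. -/
theorem contMDiffAt_differential {f : P → ℝ} {x₀ : P} (hf : ContMDiffAt (𝓡 n) 𝓘(ℝ, ℝ) ∞ f x₀) :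
    ContMDiffAt (𝓡 n) ((𝓡 n).prod 𝓘(ℝ, EuclideanSpace ℝ (Fin n) →L[ℝ] ℝ)) ∞
      (fun x ↦ Bundle.TotalSpace.mk' (EuclideanSpace ℝ (Fin n) →L[ℝ] ℝ)
        (E := fun x : P ↦ TangentSpace (𝓡 n) x →L[ℝ] Bundle.Trivial P ℝ x) x
        (mvfderiv (𝓡 n) f x)) x₀ := by
  rw [contMDiffAt_hom_bundle]
  refine ⟨contMDiffAt_id, ?_⟩
  have := hf.mfderiv_const (m := ∞) (by simp)
  refine this.congr_of_eventuallyEq ?_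
  filter_upwards with x
  ext v
  simp [inTangentCoordinates, ContinuousLinearMap.inCoordinates, mvfderiv]
  rfl

theorem BivectorField.contMDiffAt_apply (B : BivectorField n P) {x₀ : P}
    {α β : ∀ x : P, Cotangent n x}
    (hα : ContMDiffAt (𝓡 n) ((𝓡 n).prod 𝓘(ℝ, EuclideanSpace ℝ (Fin n) →L[ℝ] ℝ)) ∞
      (fun x ↦ Bundle.TotalSpace.mk' (EuclideanSpace ℝ (Fin n) →L[ℝ] ℝ)
        (E := fun x : P ↦ TangentSpace (𝓡 n) x →L[ℝ] Bundle.Trivial P ℝ x) x (α x)) x₀)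
    (hβ : ContMDiffAt (𝓡 n) ((𝓡 n).prod 𝓘(ℝ, EuclideanSpace ℝ (Fin n) →L[ℝ] ℝ)) ∞
      (fun x ↦ Bundle.TotalSpace.mk' (EuclideanSpace ℝ (Fin n) →L[ℝ] ℝ)
        (E := fun x : P ↦ TangentSpace (𝓡 n) x →L[ℝ] Bundle.Trivial P ℝ x) x (β x)) x₀) :
    ContMDiffAt (𝓡 n) 𝓘(ℝ, ℝ) ∞ (fun x ↦ B.toFun x (α x) (β x)) x₀ := by
  have h := ContMDiffAt.clm_bundle_apply₂
    (E₁ := fun x : P ↦ TangentSpace (𝓡 n) x →L[ℝ] Bundle.Trivial P ℝ x)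
    (E₂ := fun x : P ↦ TangentSpace (𝓡 n) x →L[ℝ] Bundle.Trivial P ℝ x)
    (E₃ := Bundle.Trivial P ℝ) (b := fun x : P ↦ x) (B.smooth x₀) hα hβ
  rw [Bundle.contMDiffAt_totalSpace] at h
  exact h.2

/-- The bracket of smooth functions is smooth. -/
theorem BivectorField.contMDiffAt_bracket (B : BivectorField n P) {f g : P → ℝ} {x₀ : P}
    (hf : ContMDiffAt (𝓡 n) 𝓘(ℝ, ℝ) ∞ f x₀) (hg : ContMDiffAt (𝓡 n) 𝓘(ℝ, ℝ) ∞ g x₀) :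
    ContMDiffAt (𝓡 n) 𝓘(ℝ, ℝ) ∞ (B.bracket f g) x₀ :=
  B.contMDiffAt_apply (contMDiffAt_differential hf) (contMDiffAt_differential hg)

/-- The local representation of a bivector field in a chart. -/
def BivectorField.inChart (B : BivectorField n P)
    (φ : OpenPartialHomeomorph P (EuclideanSpace ℝ (Fin n))) (z : EuclideanSpace ℝ (Fin n)) :
    (EuclideanSpace ℝ (Fin n) →L[ℝ] ℝ) →L[ℝ] (EuclideanSpace ℝ (Fin n) →L[ℝ] ℝ) →L[ℝ] ℝ :=
  let D : EuclideanSpace ℝ (Fin n) →L[ℝ] EuclideanSpace ℝ (Fin n) :=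
    mfderiv (𝓡 n) 𝓘(ℝ, EuclideanSpace ℝ (Fin n)) φ (φ.symm z)
  let b : (EuclideanSpace ℝ (Fin n) →L[ℝ] ℝ) →L[ℝ] (EuclideanSpace ℝ (Fin n) →L[ℝ] ℝ) →L[ℝ] ℝ :=
    B.toFun (φ.symm z)
  b.bilinearComp (ContinuousLinearMap.precomp ℝ D) (ContinuousLinearMap.precomp ℝ D)

theorem BivectorField.inChart_apply (B : BivectorField n P) (z : EuclideanSpace ℝ (Fin n))
    (α β : EuclideanSpace ℝ (Fin n) →L[ℝ] ℝ) :
    B.inChart φ z α β = B.toFun (φ.symm z)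
      (α ∘L mfderiv (𝓡 n) 𝓘(ℝ, EuclideanSpace ℝ (Fin n)) φ (φ.symm z))
      (β ∘L mfderiv (𝓡 n) 𝓘(ℝ, EuclideanSpace ℝ (Fin n)) φ (φ.symm z)) := rfl

theorem BivectorField.localBracket_inChart (B : BivectorField n P)
    (hφ : φ ∈ IsManifold.maximalAtlas (𝓡 n) ∞ P) {x : P} (hx : x ∈ φ.source)
    {f g : EuclideanSpace ℝ (Fin n) → ℝ} (hf : DifferentiableAt ℝ f (φ x))
    (hg : DifferentiableAt ℝ g (φ x)) :
    B.bracket (fun y ↦ f (φ y)) (fun y ↦ g (φ y)) x = localBracket (B.inChart φ) f g (φ x) := by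
  rw [localBracket, B.inChart_apply, φ.left_inv hx, BivectorField.bracket,
    mvfderiv_comp_chart hφ hx hf, mvfderiv_comp_chart hφ hx hg]

/-- On constant covectors `α`, `β` the local bivector is the bracket of the functions `α ∘ φ` and `β
∘ φ`, whose smoothness is known. -/
theorem BivectorField.inChart_smooth (B : BivectorField n P)
    (hφ : φ ∈ IsManifold.maximalAtlas (𝓡 n) ∞ P) {z₀ : EuclideanSpace ℝ (Fin n)}
    (hz₀ : z₀ ∈ φ.target) : SmoothNear (B.inChart φ) z₀ := by
  refine .of_contDiffOn φ.open_target hz₀ ?_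
  refine contDiffOn_clm_apply.mpr fun α ↦ contDiffOn_clm_apply.mpr fun β ↦ fun z hz ↦ ?_
  have hx := φ.map_target hz
  have h1 : ContMDiffAt (𝓡 n) 𝓘(ℝ, ℝ) ∞ (B.bracket (fun y ↦ α (φ y)) (fun y ↦ β (φ y)))
      (φ.symm z) := B.contMDiffAt_bracket
    (contMDiffAt_comp_chart hφ hx α.contDiff.contDiffAt)
    (contMDiffAt_comp_chart hφ hx β.contDiff.contDiffAt)
  have h2 : ContMDiffAt 𝓘(ℝ, EuclideanSpace ℝ (Fin n)) 𝓘(ℝ, ℝ) ∞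
      (fun w ↦ B.bracket (fun y ↦ α (φ y)) (fun y ↦ β (φ y)) (φ.symm w)) z :=
    ContMDiffAt.comp z h1
      ((contMDiffOn_symm_of_mem_maximalAtlas hφ).contMDiffAt (φ.open_target.mem_nhds hz))
  refine (h2.contDiffAt.congr_of_eventuallyEq ?_).contDiffWithinAt
  filter_upwards [φ.open_target.mem_nhds hz] with w hw
  rw [B.localBracket_inChart hφ (φ.map_target hw) α.differentiableAt β.differentiableAt,
    φ.right_inv hw, localBracket, α.fderiv, β.fderiv]

/-- Iterated brackets are computed in a chart. -/
theorem BivectorField.localBracket_localBracket_inChart (B : BivectorField n P)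
    (hφ : φ ∈ IsManifold.maximalAtlas (𝓡 n) ∞ P) {x : P} (hx : x ∈ φ.source)
    {f g h : EuclideanSpace ℝ (Fin n) → ℝ} (hf : SmoothNear f (φ x)) (hg : SmoothNear g (φ x))
    (hh : SmoothNear h (φ x)) :
    B.bracket (fun y ↦ f (φ y)) (B.bracket (fun y ↦ g (φ y)) (fun y ↦ h (φ y))) x =
      localBracket (B.inChart φ) f (localBracket (B.inChart φ) g h) (φ x) := by
  have hS : SmoothNear (localBracket (B.inChart φ) g h) (φ x) :=
    ((B.inChart_smooth hφ (φ.map_source hx)).clm_apply hg.fderiv).clm_apply hh.fderiv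
  have hev : B.bracket (fun y ↦ g (φ y)) (fun y ↦ h (φ y)) =ᶠ[𝓝 x]
      fun y ↦ localBracket (B.inChart φ) g h (φ y) := by
    filter_upwards [φ.open_source.mem_nhds hx,
      (φ.continuousAt hx).eventually hg, (φ.continuousAt hx).eventually hh] with y hy hgy hhy
    exact B.localBracket_inChart hφ hy (hgy.differentiableAt (by simp))
      (hhy.differentiableAt (by simp))
  rw [← B.localBracket_inChart hφ hx hf.differentiableAt hS.differentiableAt,
    BivectorField.bracket, BivectorField.bracket]
  congr 1
  exact hev.mfderiv_eq

theorem BivectorField.isPoissonNear_inChart (B : BivectorField n P) (hB : B.IsPoisson)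
    (hφ : φ ∈ IsManifold.maximalAtlas (𝓡 n) ∞ P) {z₀ : EuclideanSpace ℝ (Fin n)}
    (hz₀ : z₀ ∈ φ.target) : IsPoissonNear (B.inChart φ) z₀ where
  smooth := B.inChart_smooth hφ hz₀
  skew := Eventually.of_forall fun z α β ↦ by
    rw [B.inChart_apply, B.inChart_apply]
    exact B.skew _ _ _
  jacobi := by
    filter_upwards [φ.open_target.mem_nhds hz₀] with z hz f g h hf hg hh
    -- The test functions are smooth only near `z`; their pullbacks are admissible because the
    -- Poisson condition is tested on locally defined functions.
    obtain ⟨W, hW, hWo, hzW⟩ := eventually_nhds_iff.mp (hf.and (hg.and hh))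
    obtain ⟨x, hx, rfl⟩ : ∃ x ∈ φ.source, φ x = z := ⟨φ.symm z, φ.map_target hz, φ.right_inv hz⟩
    have key := hB _ (φ.isOpen_inter_preimage hWo) (fun y ↦ f (φ y)) (fun y ↦ g (φ y))
      (fun y ↦ h (φ y))
      (fun y hy ↦ (contMDiffAt_comp_chart hφ hy.1 (hW _ hy.2).1).contMDiffWithinAt)
      (fun y hy ↦ (contMDiffAt_comp_chart hφ hy.1 (hW _ hy.2).2.1).contMDiffWithinAt)
      (fun y hy ↦ (contMDiffAt_comp_chart hφ hy.1 (hW _ hy.2).2.2).contMDiffWithinAt) x ⟨hx, hzW⟩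
    rw [BivectorField.schoutenSquare, B.localBracket_localBracket_inChart hφ hx hf hg hh,
      B.localBracket_localBracket_inChart hφ hx hg hh hf,
      B.localBracket_localBracket_inChart hφ hx hh hf hg] at key
    linarith

end ChartBivector

/-! ### Charts straightening an embedded submanifold. -/

section Slice

variable {n m : ℕ} {P : Type*} [TopologicalSpace P]
  [ChartedSpace (EuclideanSpace ℝ (Fin n)) P]
  {M : Type*} [TopologicalSpace M] [ChartedSpace (EuclideanSpace ℝ (Fin m)) M]

/-- An embedded submanifold is a linear subspace in a suitable chart. -/
theorem exists_slice_chart {i : M → P} (hi : Manifold.IsSmoothEmbedding (𝓡 m) (𝓡 n) ∞ i) (x : M) :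
    ∃ φ ∈ IsManifold.maximalAtlas (𝓡 n) ∞ P, ∃ V : Submodule ℝ (EuclideanSpace ℝ (Fin n)),
      ∃ S : Set M, Module.finrank ℝ V = m ∧ x ∈ S ∧
      (∀ y ∈ S, i y ∈ φ.source ∧
        ∀ v, v ∈ V ↔ ∃ w ∈ tangentSub (m := m) (n := n) i y,
          mfderiv (𝓡 n) 𝓘(ℝ, EuclideanSpace ℝ (Fin n)) φ (i y) w = v) ∧
      (∀ᶠ z in 𝓝 (φ (i x)), φ.symm z ∈ range i ↔ z ∈ V) ∧
      ∀ᶠ z in 𝓝 (φ (i x)), z ∈ V → ∃ y ∈ S, φ (i y) = z := by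
  have h := hi.isImmersion.isImmersionAt x
  set φ := h.codChart with hφ
  set ψ := h.domChart with hψ
  have hφm : φ ∈ IsManifold.maximalAtlas (𝓡 n) ∞ P := h.codChart_mem_maximalAtlas
  have hψm : ψ ∈ IsManifold.maximalAtlas (𝓡 m) ∞ M := h.domChart_mem_maximalAtlas
  let J : EuclideanSpace ℝ (Fin m) →L[ℝ] EuclideanSpace ℝ (Fin n) :=
    h.equiv.toContinuousLinearMap ∘L ContinuousLinearMap.inl ℝ _ _
  have hJ : ∀ u, J u = h.equiv (u, 0) := fun u ↦ rfl
  have hJinj : Function.Injective J := fun u v huv ↦ by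
    have := h.equiv.injective huv
    simpa using this
  have hsrc : ∀ y ∈ ψ.source, i y ∈ φ.source := fun y hy ↦ h.source_subset_preimage_source hy
  have hchart : ∀ y ∈ ψ.source, φ (i y) = J (ψ y) := fun y hy ↦ by
    have := h.writtenInCharts
      (show ψ y ∈ (h.domChart.extend (𝓡 m)).target by simpa using ψ.map_source hy)
    rw [hJ]
    simpa [← hψ, ← hφ, ψ.left_inv hy] using this
  have hsurj : ∀ u ∈ ψ.target, ∃ y ∈ ψ.source, φ (i y) = J u := fun u hu ↦
    ⟨ψ.symm u, ψ.map_target hu, by rw [hchart _ (ψ.map_target hu), ψ.right_inv hu]⟩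
  have hxs : x ∈ ψ.source := h.mem_domChart_source
  have hev : ∀ᶠ z in 𝓝 (φ (i x)), (h.equiv.symm z).1 ∈ ψ.target := by
    refine (continuous_fst.comp h.equiv.symm.continuous).continuousAt.eventually_mem
      (ψ.open_target.mem_nhds ?_)
    simpa [hchart x hxs, hJ] using ψ.map_source hxs
  have hev' : ∀ᶠ z in 𝓝 (φ (i x)), z ∈ LinearMap.range J.toLinearMap →
      ∃ y ∈ ψ.source, φ (i y) = z := by
    filter_upwards [hev] with z hz
    rintro ⟨u, rfl⟩
    exact hsurj u (by simpa [hJ] using hz)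
  -- Embeddedness enters here: points of `M` whose images are close to `i x` already lie in the
  -- domain of `ψ`, so no other sheet of `M` meets the slice.
  obtain ⟨O, hO, hOS⟩ := hi.isEmbedding.isInducing.isOpen_iff.mp ψ.open_source
  refine ⟨φ, hφm, LinearMap.range J.toLinearMap, ψ.source, ?_, hxs,
    fun y hy ↦ ⟨hsrc y hy, ?_⟩, ?_, hev'⟩
  · rw [LinearMap.finrank_range_of_inj hJinj, finrank_euclideanSpace_fin]
  · have hiy : MDifferentiableAt (𝓡 m) (𝓡 n) i y :=
      (hi.isImmersion.contMDiff y).mdifferentiableAt (by simp)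
    have h1 := mfderiv_comp y ((mdifferentiable_chart hφm).mdifferentiableAt (hsrc y hy)) hiy
    have h2 : mfderiv (𝓡 m) 𝓘(ℝ, EuclideanSpace ℝ (Fin n)) (φ ∘ i) y =
        mfderiv (𝓡 m) 𝓘(ℝ, EuclideanSpace ℝ (Fin n)) (J ∘ ψ) y := by
      refine Filter.EventuallyEq.mfderiv_eq ?_
      filter_upwards [ψ.open_source.mem_nhds hy] with w hw using hchart w hw
    have h3 := mfderiv_comp (I' := 𝓘(ℝ, EuclideanSpace ℝ (Fin m))) y
      (J.differentiableAt.mdifferentiableAt (x := ψ y))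
      ((mdifferentiable_chart hψm).mdifferentiableAt hy)
    rw [mfderiv_eq_fderiv, J.fderiv] at h3
    rw [h1, h3] at h2
    have hs := (mdifferentiable_chart hψm).mfderiv_surjective hy
    intro v
    constructor
    · rintro ⟨u, rfl⟩
      obtain ⟨w, rfl⟩ := hs u
      exact ⟨_, ⟨w, rfl⟩, DFunLike.congr_fun h2 w⟩
    · rintro ⟨_, ⟨w, rfl⟩, rfl⟩
      exact ⟨_, (DFunLike.congr_fun h2 w).symm⟩
  · filter_upwards [hev', φ.open_target.mem_nhds (φ.map_source (hsrc x hxs)),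
      (φ.continuousAt_symm (φ.map_source (hsrc x hxs))).eventually_mem
        (hO.mem_nhds (by rw [φ.left_inv (hsrc x hxs)]; exact hOS.symm.subset hxs))] with z h1 h2 h3
    refine ⟨?_, fun hz ↦ ?_⟩
    · rintro ⟨y, hy⟩
      have hyS : y ∈ ψ.source := hOS.subset (by rw [mem_preimage, hy]; exact h3)
      exact ⟨ψ y, by rw [← φ.right_inv h2, ← hy]; exact (hchart y hyS).symm⟩
    · obtain ⟨y, hy, rfl⟩ := h1 hz
      exact ⟨y, (φ.left_inv (hsrc y hy)).symm⟩

end Slice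

/-! ### Coisotropy and the rank condition in a slice chart. -/

section Transfer

variable {n m : ℕ} {P : Type*} [TopologicalSpace P]
  [ChartedSpace (EuclideanSpace ℝ (Fin n)) P]
  {M : Type*} [TopologicalSpace M] [ChartedSpace (EuclideanSpace ℝ (Fin m)) M]
  {φ : OpenPartialHomeomorph P (EuclideanSpace ℝ (Fin n))}
  {V : Submodule ℝ (EuclideanSpace ℝ (Fin n))} {i : M → P}

theorem finrank_conormal_add (i : M → P) (y : M) :
    Module.finrank ℝ (tangentSub (m := m) (n := n) i y) +
      Module.finrank ℝ (conormal (m := m) (n := n) i y) = n := by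
  have h : conormal (m := m) (n := n) i y =
      (tangentSub (m := m) (n := n) i y).dualAnnihilator.map
        (LinearMap.toContinuousLinearMap :
          (TangentSpace (𝓡 n) (i y) →ₗ[ℝ] ℝ) ≃ₗ[ℝ] Cotangent n (i y)).toLinearMap := by
    ext ξ
    constructor
    · intro hξ
      exact ⟨ξ.toLinearMap, (Submodule.mem_dualAnnihilator _).mpr hξ, rfl⟩
    · rintro ⟨ζ, hζ, rfl⟩ v hv
      exact (Submodule.mem_dualAnnihilator _).mp hζ v hv
  rw [h, LinearEquiv.finrank_map_eq, Subspace.finrank_add_finrank_dualAnnihilator_eq]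
  exact finrank_euclideanSpace_fin

theorem comp_mfderiv_mem_conormal_iff {y : M}
    (hV : ∀ v, v ∈ V ↔ ∃ w ∈ tangentSub (m := m) (n := n) i y,
      mfderiv (𝓡 n) 𝓘(ℝ, EuclideanSpace ℝ (Fin n)) φ (i y) w = v)
    (α : EuclideanSpace ℝ (Fin n) →L[ℝ] ℝ) :
    α ∘L mfderiv (𝓡 n) 𝓘(ℝ, EuclideanSpace ℝ (Fin n)) φ (i y) ∈
      conormal (m := m) (n := n) i y ↔ ∀ v ∈ V, α v = 0 := by
  constructor
  · intro h v hv
    obtain ⟨w, hw, rfl⟩ := (hV v).mp hv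
    exact h w hw
  · exact fun h w hw ↦ h _ ((hV _).mpr ⟨w, hw, rfl⟩)

theorem coordVec_trans {k l : ℕ} (hφ : φ ∈ IsManifold.maximalAtlas (𝓡 n) ∞ P)
    {e : OpenPartialHomeomorph (EuclideanSpace ℝ (Fin n)) (CoordSpace k l)}
    (he : ContDiffOn ℝ ∞ e.symm e.target) (a : Fin k ⊕ Fin k ⊕ Fin l) {z : CoordSpace k l}
    (hz : z ∈ (φ.trans e).target) :
    coordVec (n := n) (φ.trans e) a z =
      mfderiv 𝓘(ℝ, EuclideanSpace ℝ (Fin n)) (𝓡 n) φ.symm (e.symm z) 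
        (frameVec (E := EuclideanSpace ℝ (Fin n)) e a z) := by
  rw [OpenPartialHomeomorph.trans_target] at hz
  have he' : DifferentiableAt ℝ e.symm z :=
    (he.contDiffAt (e.open_target.mem_nhds hz.1)).differentiableAt (by simp)
  have h := mfderiv_comp (I := 𝓘(ℝ, CoordSpace k l)) z
    ((mdifferentiable_chart hφ).symm.mdifferentiableAt hz.2) he'.mdifferentiableAt
  rw [mfderiv_eq_fderiv] at h
  exact DFunLike.congr_fun h _

variable [IsManifold (𝓡 n) ∞ P]

theorem BivectorField.toFun_eq_inChart (B : BivectorField n P)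
    (hφ : φ ∈ IsManifold.maximalAtlas (𝓡 n) ∞ P) {w : EuclideanSpace ℝ (Fin n)}
    (hw : w ∈ φ.target) (α β : Cotangent n (φ.symm w)) :
    B.toFun (φ.symm w) α β = B.inChart φ w
      (α ∘L mfderiv 𝓘(ℝ, EuclideanSpace ℝ (Fin n)) (𝓡 n) φ.symm w)
      (β ∘L mfderiv 𝓘(ℝ, EuclideanSpace ℝ (Fin n)) (𝓡 n) φ.symm w) := by
  have h := (mdifferentiable_chart hφ).symm_comp_deriv (φ.map_target hw)
  rw [φ.right_inv hw] at h
  have key : ∀ γ : Cotangent n (φ.symm w),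
      (γ ∘L mfderiv 𝓘(ℝ, EuclideanSpace ℝ (Fin n)) (𝓡 n) φ.symm w) ∘L
        mfderiv (𝓡 n) 𝓘(ℝ, EuclideanSpace ℝ (Fin n)) φ (φ.symm w) = γ := fun γ ↦ by
    ext v
    exact congrArg γ (DFunLike.congr_fun h v)
  rw [B.inChart_apply]
  erw [key α, key β]

/-- Rank–nullity: `♯` maps the conormal space onto a space of the same dimension, so its kernel
there is trivial. -/
theorem BivectorField.eq_zero_of_sharp_eq_zero (B : BivectorField n P) {i : M → P} {y : M}
    (hrank : Module.finrank ℝ (B.sharpConormal (m := m) i y) =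
      Module.finrank ℝ (conormal (m := m) (n := n) i y))
    {ξ : Cotangent n (i y)} (hξ : ξ ∈ conormal (m := m) (n := n) i y)
    (h : B.sharp (i y) ξ = 0) : ξ = 0 := by
  have h1 := ((B.sharp (i y)).domRestrict
    (conormal (m := m) (n := n) i y)).finrank_range_add_finrank_ker
  rw [LinearMap.range_domRestrict] at h1
  have h2 : LinearMap.ker ((B.sharp (i y)).domRestrict (conormal (m := m) (n := n) i y)) = ⊥ := by
    refine Submodule.finrank_eq_zero.mp ?_
    rw [BivectorField.sharpConormal] at hrank
    omega
  exact congrArg Subtype.val (LinearMap.ker_eq_bot'.mp h2 ⟨ξ, hξ⟩ h)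

/-- For conormal `α` and `β`, the value `Π(α, β) = β(♯α)` vanishes because `♯α` is tangent to `M`.
-/
theorem BivectorField.isCoisotropicNear_inChart (B : BivectorField n P)
    (hB : B.IsCoisotropic (m := m) i) {S : Set M} {z₀ : EuclideanSpace ℝ (Fin n)}
    (hS : ∀ y ∈ S, i y ∈ φ.source ∧ ∀ v, v ∈ V ↔ ∃ w ∈ tangentSub (m := m) (n := n) i y,
      mfderiv (𝓡 n) 𝓘(ℝ, EuclideanSpace ℝ (Fin n)) φ (i y) w = v)
    (h : ∀ᶠ z in 𝓝 z₀, z ∈ V → ∃ y ∈ S, φ (i y) = z) :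
    IsCoisotropicNear (B.inChart φ) V z₀ := by
  filter_upwards [h] with z hz hzV α β hα hβ
  obtain ⟨y, hy, rfl⟩ := hz hzV
  rw [B.inChart_apply, φ.left_inv (hS y hy).1, ← B.apply_sharp]
  exact (comp_mfderiv_mem_conormal_iff (hS y hy).2 β).mpr hβ _
    (hB y (Submodule.mem_map_of_mem ((comp_mfderiv_mem_conormal_iff (hS y hy).2 α).mpr hα)))

theorem BivectorField.eq_zero_of_inChart_eq_zero (B : BivectorField n P)
    (hφ : φ ∈ IsManifold.maximalAtlas (𝓡 n) ∞ P) {y : M} (hy : i y ∈ φ.source)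
    (hV : ∀ v, v ∈ V ↔ ∃ w ∈ tangentSub (m := m) (n := n) i y,
      mfderiv (𝓡 n) 𝓘(ℝ, EuclideanSpace ℝ (Fin n)) φ (i y) w = v)
    (hrank : Module.finrank ℝ (B.sharpConormal (m := m) i y) + Module.finrank ℝ V = n)
    {α : EuclideanSpace ℝ (Fin n) →L[ℝ] ℝ} (hα : ∀ v ∈ V, α v = 0)
    (h : ∀ β, B.inChart φ (φ (i y)) α β = 0) : α = 0 := by
  let D := (mdifferentiable_chart hφ).mfderiv hy
  have hD : ∀ v, D v = mfderiv (𝓡 n) 𝓘(ℝ, EuclideanSpace ℝ (Fin n)) φ (i y) v := fun v ↦ rfl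
  have hVT : Module.finrank ℝ V = Module.finrank ℝ (tangentSub (m := m) (n := n) i y) := by
    have h1 : (tangentSub (m := m) (n := n) i y).map D.toLinearEquiv.toLinearMap = V :=
      (Submodule.ext hV).symm
    have h2 := D.toLinearEquiv.finrank_map_eq (tangentSub (m := m) (n := n) i y)
    rw [h1] at h2
    exact h2
  have hξ := (comp_mfderiv_mem_conormal_iff hV α).mpr hα
  have h0 := B.eq_zero_of_sharp_eq_zero
    (by have := finrank_conormal_add (m := m) (n := n) i y; omega) hξ (by
      refine (Module.forall_dual_apply_eq_zero_iff ℝ _).mp fun f ↦ ?_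
      let η : Cotangent n (i y) := LinearMap.toContinuousLinearMap f
      change η _ = 0
      rw [B.apply_sharp, ← h (η ∘L D.symm.toContinuousLinearMap), B.inChart_apply,
        φ.left_inv hy]
      congr 1
      ext v
      exact congrArg η (D.symm_apply_apply v).symm)
  ext v
  obtain ⟨w, rfl⟩ := D.surjective v
  exact DFunLike.congr_fun h0 w

end Transfer

end PoissonGeom

end

/-! ### The theorem: a slice chart followed by canonical coordinates. -/

theorem mainTheorem8 {n m k : ℕ}
    {P : Type*} [TopologicalSpace P] [ChartedSpace (EuclideanSpace ℝ (Fin n)) P]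
    [IsManifold (𝓡 n) ∞ P]
    (B : PoissonGeom.BivectorField n P) (hB : B.IsPoisson)
    {M : Type*} [TopologicalSpace M] [ChartedSpace (EuclideanSpace ℝ (Fin m)) M]
    [IsManifold (𝓡 m) ∞ M]
    (i : M → P) (hi : Manifold.IsSmoothEmbedding (𝓡 m) (𝓡 n) ∞ i)
    (hcodim : m + k = n)
    (hcois : B.IsCoisotropic (m := m) i)
    (hrank : ∀ y : M, Module.finrank ℝ (B.sharpConormal (m := m) i y) = k)
    (x : M) :
    ∃ e : OpenPartialHomeomorph P (PoissonGeom.CoordSpace k (m - k)),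
      i x ∈ e.source ∧
      ContMDiffOn (𝓡 n) 𝓘(ℝ, PoissonGeom.CoordSpace k (m - k)) ∞ e e.source ∧
      ContMDiffOn 𝓘(ℝ, PoissonGeom.CoordSpace k (m - k)) (𝓡 n) ∞ e.symm e.target ∧
      (∀ z ∈ e.source, z ∈ Set.range i ↔ ∀ I : Fin k, e z (PoissonGeom.ip I) = 0) ∧
      ∃ φ : Fin (m - k) → Fin (m - k) → EuclideanSpace ℝ (Fin (m - k)) → ℝ,
        (∀ a b, ContDiff ℝ ∞ (φ a b)) ∧
        ∀ z ∈ e.target, ∀ α β : PoissonGeom.Cotangent n (e.symm z),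
          B.toFun (e.symm z) α β =
            (∑ I : Fin k, PoissonGeom.wedge
              (PoissonGeom.coordVec e (PoissonGeom.iq I) z)
              (PoissonGeom.coordVec e (PoissonGeom.ip I) z) α β) +
            ∑ a : Fin (m - k), ∑ b : Fin (m - k),
              φ a b (PoissonGeom.yPart z) * PoissonGeom.wedge
                (PoissonGeom.coordVec e (PoissonGeom.iy a) z)
                (PoissonGeom.coordVec e (PoissonGeom.iy b) z) α β := by
  open PoissonGeom in
  obtain ⟨φ, hφ, V, S, hVm, hxS, hS, hslice, hVS⟩ := exists_slice_chart hi x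
  have hx := (hS x hxS).1
  have hxV : φ (i x) ∈ V := by
    refine hslice.self_of_nhds.mp ?_
    rw [φ.left_inv hx]
    exact Set.mem_range_self x
  -- The neighbourhood `U` is the set supplied by `hslice`, where membership in `V` means membership
  -- in the image of `M`; so `V = {p = 0}` transfers to `M`.
  obtain ⟨e, hxe, heU, he, he', hV, c, hc, hBc⟩ := exists_canonical_chart (k := k) (l := m - k)
    (B.isPoissonNear_inChart hB hφ (φ.map_source hx)) (B.isCoisotropicNear_inChart hcois hS hVS)
    hxV
    (fun α hα h ↦ B.eq_zero_of_inChart_eq_zero hφ hx (hS x hxS).2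
      (by rw [hrank x, hVm]; omega) hα h)
    (by rw [hVm, finrank_euclideanSpace_fin, hcodim]) (by rw [hVm])
    hslice
  refine ⟨φ.trans e, ?_, ?_, ?_, ?_, c, hc, ?_⟩
  · rw [OpenPartialHomeomorph.trans_source]
    exact ⟨hx, hxe⟩
  · rw [OpenPartialHomeomorph.trans_source]
    exact he.contMDiffOn.comp ((contMDiffOn_of_mem_maximalAtlas hφ).mono Set.inter_subset_left)
      Set.inter_subset_right
  · rw [OpenPartialHomeomorph.trans_target]
    exact (contMDiffOn_symm_of_mem_maximalAtlas hφ).comp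
      (he'.contMDiffOn.mono Set.inter_subset_left) Set.inter_subset_right
  · intro z hz
    rw [OpenPartialHomeomorph.trans_source] at hz
    have h := heU hz.2
    rw [Set.mem_ofPred_eq, φ.left_inv hz.1] at h
    exact h.trans (hV _ hz.2)
  · intro z hz α β
    have hz' := hz
    rw [OpenPartialHomeomorph.trans_target] at hz'
    have h1 := B.toFun_eq_inChart hφ hz'.2 α β
    rw [hBc z hz'.1] at h1
    simp only [wedge, coordVec_trans hφ he' _ hz]
    exact h1
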